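/- For an even integer $k\ge 4$ let $B_k$ be the $k$-th Bernoulli number, $\sigma_{\ell}(n)=\sum_{d\mid n}d^{\ell}$, and let $$E_k(z)=1-\frac{2k}{B_k}\sum_{n\ge 1}\sigma_{k-1}(n)\,q_z^n,\qquad q_z=e^{2\pi i z},\quad \operatorname{Im} z>0,$$ be the normalized Eisenstein series of weight $k$ for $\mathrm{SL}_2(\mathbb Z)$. Write $\mathrm E_k(q)=1-\frac{2k}{B_k}\sum_{n\ge1}\sigma_{k-1}(n)q^n$ for its $q$-expansion, $\Theta=q\frac{\mathrm d}{\mathrm dq}$, so that $\Theta(\sum a(n)q^n)=\sum n\,a(n)q^n$, and define $\beta_k(n)$ by the formal power series identity $\frac1{\mathrm E_k(q)}=\sum_{n\ge 0}\beta_k(n)q^n$. Let $$\mathbb F=\{|z|\ge 1,\ 0\le \operatorname{Re} z\le \tfrac12\}\cup\{|z|>1,\ -\tfrac12<\operatorname{Re} z<0\}$$ be the standard fundamental domain of $\mathrm{SL}_2(\mathbb Z)$ in the upper half plane. Theorem. Let $k\ge 12$ be an integer with $k\equiv 0\pmod 4$. Then among the zeros of $E_k$ in $\mathbb F$ there is exactly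 one, $z_k$, of largest imaginary part. The power series $\sum_{n\ge0}\beta_k(n)q^n$ has radius of convergence $|q_{z_k}|$; for every $w$ in the upper half plane with $|q_w|<|q_{z_k}|$ one has $E_k(w)\ne 0$ and $\sum_{n\ge 0}\beta_k(n)q_w^n=1/E_k(w)$. Moreover $\Theta(\mathrm E_k)(q_{z_k})\neq 0$, $\Theta(\mathrm E_k)(\overline{q_{z_k}})\ne 0$, and $$\lim_{n\to\infty}\left(\beta_k(n)\,q_{z_k}^{\,n}+\frac1{\Theta(\mathrm E_k)(q_{z_k})}+\frac1{\Theta(\mathrm E_k)(\overline{q_{z_k}})}\left(\frac{q_{z_k}}{\overline{q_{z_k}}}\right)^{n}\right)=0 .$$ -/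

import Mathlib

/-- The nome `q_z = e^{2πiz}` of a point `z` of the upper half plane. -/
noncomputable def nome (z : UpperHalfPlane) : ℂ :=
  Complex.exp (2 * (Real.pi : ℂ) * Complex.I * (z : ℂ))

/-- The standard fundamental domain `𝔽` of `SL₂(ℤ)`, with one half of its boundary. -/
def standardDomain : Set UpperHalfPlane :=
  {z | 1 ≤ ‖(z : ℂ)‖ ∧ 0 ≤ z.re ∧ z.re ≤ 1 / 2} ∪
    {z | 1 < ‖(z : ℂ)‖ ∧ -(1 / 2) < z.re ∧ z.re < 0}

/-- The `q`-expansion `1 - (2k / B_k) ∑_{n ≥ 1} σ_{k-1}(n) q^n` of the normalized Eisenstein series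
`E_k`, as a formal power series. -/
noncomputable def eisensteinQ {k : ℕ} (hk : 3 ≤ k) : PowerSeries ℂ :=
  UpperHalfPlane.qExpansion 1 (ModularForm.E hk)

/-- The coefficients of the power series `eisensteinQ` (a check against the classical formula). -/
theorem eisensteinQ_coeff {k : ℕ} (hk : 3 ≤ k) (hk2 : Even k) (n : ℕ) :
    (eisensteinQ hk).coeff n =
      if n = 0 then 1 else -(2 * k / bernoulli k : ℂ) * (ArithmeticFunction.sigma (k - 1) n) :=
  EisensteinSeries.E_qExpansion_coeff hk hk2 n

/-- `β_k(n)`: the `n`-th coefficient of the formal power series `1 / E_k`. -/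
noncomputable def reciprocalCoeff {k : ℕ} (hk : 3 ≤ k) (n : ℕ) : ℂ :=
  (eisensteinQ hk)⁻¹.coeff n

/-- The Ramanujan operator `Θ = q d/dq` on formal power series,
`∑ a(n) q^n ↦ ∑ n a(n) q^n`. -/
noncomputable def ramanujanTheta (f : PowerSeries ℂ) : PowerSeries ℂ :=
  PowerSeries.mk fun n => (n : ℂ) * f.coeff n

/-- The value at `q` of a power series with complex coefficients (meaningful where it converges). -/
noncomputable def seriesValue (f : PowerSeries ℂ) (q : ℂ) : ℂ :=
  ∑' n : ℕ, f.coeff n * q ^ n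

/-- `z` is a zero of `E_k` in the standard fundamental domain whose imaginary part is the largest
among all zeros of `E_k` in that domain. -/
def IsHighestZero {k : ℕ} (hk : 3 ≤ k) (z : UpperHalfPlane) : Prop :=
  z ∈ standardDomain ∧ ModularForm.E hk z = 0 ∧
    ∀ w ∈ standardDomain, ModularForm.E hk w = 0 → w.im ≤ z.im

/-!
The proof needs only the zeros of `E_k` that are at least as high as the highest one, so neither
the valence formula nor the full Rankin–Swinnerton-Dyer theorem enters.

*Location of the highest zero.* As half the sum of `(c z + d)^{-k}` over coprime pairs, the
Eisenstein series is `1 + z^{-k} + g(z)`, with `g` collecting the pairs with `c d ≠ 0`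
(`E_eq_one_add_inv_pow_add_eisRemainder`). In the coordinate `z = i e^{-iπw/k}` the condition
`4 ∣ k` turns `1 + z^{-k}` into `1 + e^{iπw}`, whose zero `w = 1` is the one closest to `z = i`
with `Re z > 0`. For `z` near the top of the fundamental domain the remainder is less than `1 / 2`
in modulus (`norm_eisRemainder_le`), and this forces the coordinate of a zero into the small
rectangle `arcBox` around `w = 1` (`exists_mem_arcBox_of_zero`). A priori the coordinate could
also lie close to `w = 3, 5, …`; height excludes this, since such a point would need a modulus
`|z|` exceeding `1` by an amount of order `1 / k²`, so that `1 - |z|^{-k}` is of order `1 / k` and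
beats `g`, which decays geometrically in `k`. On `arcBox` the map `w ↦ e^{iπw}` expands distances
by more than the Lipschitz constant of `g`, so `E_k` is injective there with an expansion constant (`norm_arcEisenstein_sub_ge`):
there is at most one zero, and it is simple. It exists and lies on the unit circle because
`e^{-iπw/2} E_k` is real for real `w` and changes sign (`exists_arc_zero`). Applying `z ↦ z + 1`
and `z ↦ -1 / z`, every zero in the half plane of height at least that of `z_k` is a translate of
`z_k` or `-z̄_k` (`nome_eq_of_zero`).

*Asymptotics.* Consequently `1 / E_k`, as a function of `q`, has on the disc `|q| ≤ |q_{z_k}|`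
exactly two singularities, simple poles at `q_{z_k}` and at its conjugate. Subtracting the two
principal parts gives a function holomorphic on a larger disc (`exists_reciprocal_sub_poles`),
whose Taylor coefficients are `o(|q_{z_k}|^{-n})`; the coefficients of the principal parts are the
two terms in the limit (`reciprocal_coeff_tendsto`).
-/

/-! ### Power series and reciprocals with two simple poles -/

theorem powerSeries_coeff_unique {a b : ℕ → ℂ} {F : ℂ → ℂ} {r : ℝ} (hr : 0 < r)
    (ha : ∀ q : ℂ, ‖q‖ < r → HasSum (fun n => a n * q ^ n) (F q))
    (hb : ∀ q : ℂ, ‖q‖ < r → HasSum (fun n => b n * q ^ n) (F q)) : a = b := by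
  have key : ∀ c : ℕ → ℂ, (∀ q : ℂ, ‖q‖ < r → HasSum (fun n => c n * q ^ n) (F q)) →
      HasFPowerSeriesAt F (FormalMultilinearSeries.ofScalars ℂ c) 0 := by
    intro c hc
    rw [hasFPowerSeriesAt_iff]
    filter_upwards [Metric.ball_mem_nhds (0 : ℂ) hr] with q hq
    simpa [FormalMultilinearSeries.coeff_ofScalars, mul_comm] using hc q (by simpa using hq)
  have h := (key a ha).eq_formalMultilinearSeries (key b hb)
  ext n
  simpa [FormalMultilinearSeries.coeff_ofScalars] using
    congr_arg (FormalMultilinearSeries.coeff · n) h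

theorem powerSeries_hasSum_mul (f g : PowerSeries ℂ) {q x y : ℂ}
    (hf : HasSum (fun n => f.coeff n * q ^ n) x) (hg : HasSum (fun n => g.coeff n * q ^ n) y) :
    HasSum (fun n => (f * g).coeff n * q ^ n) (x * y) := by
  have hterm : ∀ n, ∑ kl ∈ Finset.HasAntidiagonal.antidiagonal n,
      (f.coeff kl.1 * q ^ kl.1) * (g.coeff kl.2 * q ^ kl.2) = (f * g).coeff n * q ^ n := by
    intro n
    rw [PowerSeries.coeff_mul, Finset.sum_mul]
    refine Finset.sum_congr rfl fun kl hkl => ?_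
    rw [← Finset.HasAntidiagonal.mem_antidiagonal.mp hkl, pow_add]
    ring
  have hs := summable_norm_sum_mul_antidiagonal_of_summable_norm
    hf.summable.norm hg.summable.norm
  have ht := tsum_mul_tsum_eq_tsum_sum_antidiagonal_of_summable_norm
    hf.summable.norm hg.summable.norm
  rw [hf.tsum_eq, hg.tsum_eq] at ht
  rw [ht]
  simp only [hterm] at hs ⊢
  exact hs.of_norm.hasSum

theorem powerSeries_hasSum_one (q : ℂ) :
    HasSum (fun n => (1 : PowerSeries ℂ).coeff n * q ^ n) 1 := by
  have h := hasSum_single (f := fun n => (1 : PowerSeries ℂ).coeff n * q ^ n) 0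
    fun n hn => by simp [PowerSeries.coeff_one, hn]
  simpa using h

/-- A holomorphic function on a disc around `0` is the sum of a power series there. -/
theorem exists_hasSum_of_differentiableOn_ball {F : ℂ → ℂ} {r : ℝ}
    (hF : DifferentiableOn ℂ F (Metric.ball 0 r)) :
    ∃ c : ℕ → ℂ, ∀ q : ℂ, ‖q‖ < r → HasSum (fun n => c n * q ^ n) (F q) := by
  refine ⟨fun n => (n.factorial : ℂ)⁻¹ * iteratedDeriv n F 0, fun q hq => ?_⟩
  have h := Complex.hasSum_taylorSeries_on_ball hF (by simpa using hq : q ∈ Metric.ball 0 r)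
  convert! h using 2 with n
  simp only [sub_zero, smul_eq_mul]
  ring

/-- The formal inverse `f⁻¹` sums to `1 / F` on any disc where `F` has no zero. -/
theorem reciprocal_hasSum {f : PowerSeries ℂ} {F : ℂ → ℂ} {r : ℝ} (hr : 0 < r)
    (hF : DifferentiableOn ℂ F (Metric.ball 0 r))
    (hf : ∀ q : ℂ, ‖q‖ < r → HasSum (fun n => f.coeff n * q ^ n) (F q))
    (h0 : ∀ q : ℂ, ‖q‖ < r → F q ≠ 0) {q : ℂ} (hq : ‖q‖ < r) :
    HasSum (fun n => f⁻¹.coeff n * q ^ n) (F q)⁻¹ := by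
  obtain ⟨c, hc⟩ := exists_hasSum_of_differentiableOn_ball
    (hF.inv fun q hq => h0 q (by simpa using hq))
  have h1 : f * PowerSeries.mk c = 1 := by
    have := powerSeries_coeff_unique (a := fun n => (f * PowerSeries.mk c).coeff n)
      (b := fun n => (1 : PowerSeries ℂ).coeff n) (F := fun _ => 1) hr ?_ ?_
    · ext n; exact congrFun this n
    · intro q hq
      have := powerSeries_hasSum_mul f (PowerSeries.mk c) (hf q hq)
        (by simpa using hc q hq)
      simpa [h0 q hq] using this
    · intro q _
      exact powerSeries_hasSum_one q
  have h2 : f⁻¹ = PowerSeries.mk c := by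
    have hne : PowerSeries.constantCoeff f ≠ 0 := fun h => by
      have := congrArg PowerSeries.constantCoeff h1
      simp [h] at this
    rw [PowerSeries.inv_eq_iff_mul_eq_one hne, mul_comm]
    exact h1
  simpa [h2] using hc q hq

/-- Division of a holomorphic function by two distinct linear factors. -/
theorem exists_factor_two {N : ℂ → ℂ} {R : ℝ} {q₀ q₁ : ℂ}
    (hN : DifferentiableOn ℂ N (Metric.ball 0 R)) (h₀ : ‖q₀‖ < R) (h₁ : ‖q₁‖ < R) (hne : q₀ ≠ q₁)
    (hz₀ : N q₀ = 0) (hz₁ : N q₁ = 0) :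
    ∃ H : ℂ → ℂ, DifferentiableOn ℂ H (Metric.ball 0 R) ∧
      ∀ q, N q = (q - q₀) * (q - q₁) * H q := by
  have hN1 : ∀ q, N q = (q - q₀) * dslope N q₀ q := fun q => by
    have := sub_smul_dslope N q₀ q
    simp only [smul_eq_mul, hz₀, sub_zero] at this
    exact this.symm
  have hd1 : dslope N q₀ q₁ = 0 := by
    have := hN1 q₁
    rw [hz₁, zero_eq_mul] at this
    exact this.resolve_left (sub_ne_zero.2 hne.symm)
  have hm : ∀ p : ℂ, ‖p‖ < R → Metric.ball (0 : ℂ) R ∈ nhds p := fun p hp =>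
    Metric.isOpen_ball.mem_nhds (by simpa using hp)
  refine ⟨dslope (dslope N q₀) q₁, ?_, fun q => ?_⟩
  · rw [Complex.differentiableOn_dslope (hm _ h₁), Complex.differentiableOn_dslope (hm _ h₀)]
    exact hN
  · have := sub_smul_dslope (dslope N q₀) q₁ q
    simp only [smul_eq_mul, hd1, sub_zero] at this
    rw [mul_assoc, this, ← hN1 q]

/-- The geometric series of a simple pole `p`. -/
theorem hasSum_simple_pole {p q : ℂ} (h : ‖q‖ < ‖p‖) :
    HasSum (fun n : ℕ => -(1 / p ^ (n + 1)) * q ^ n) (1 / (q - p)) := by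
  have hp : p ≠ 0 := by
    rintro rfl
    simp only [norm_zero] at h
    exact absurd h (not_lt.2 (norm_nonneg _))
  have hqp : q - p ≠ 0 := fun h' => by
    rw [sub_eq_zero.1 h'] at h; exact lt_irrefl _ h
  have := (hasSum_geometric_of_norm_lt_one (ξ := q / p)
    (by rw [norm_div, div_lt_one (norm_pos_iff.2 hp)]; exact h)).mul_left (-(1 / p))
  have hpq : p - q ≠ 0 := fun h' => hqp (by linear_combination -h')
  have e : -(1 / p) * (1 - q / p)⁻¹ = 1 / (q - p) := by
    rw [one_sub_div hp, inv_div, ← neg_sub p q]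
    field_simp
  rw [← e]
  convert! this using 2 with n
  rw [div_pow, pow_succ]
  field_simp

/-- The singular part of the reciprocal: with only two simple zeros `q₀`, `q₁` of the same modulus
in the closed disc, subtracting the two principal parts of `1 / F` leaves a function that is
holomorphic on a strictly larger disc. -/
theorem exists_reciprocal_sub_poles {F : ℂ → ℂ} {q₀ q₁ : ℂ}
    (hF : DifferentiableOn ℂ F (Metric.ball 0 1)) (h₀ : ‖q₀‖ < 1)
    (hmod : ‖q₁‖ = ‖q₀‖) (hne : q₀ ≠ q₁) (hz₀ : F q₀ = 0) (hz₁ : F q₁ = 0)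
    (hzeros : ∀ q, ‖q‖ ≤ ‖q₀‖ → F q = 0 → q = q₀ ∨ q = q₁)
    (hd₀ : deriv F q₀ ≠ 0) (hd₁ : deriv F q₁ ≠ 0) :
    ∃ (R : ℝ) (h : ℂ → ℂ), ‖q₀‖ < R ∧ DifferentiableOn ℂ h (Metric.ball 0 R) ∧
      ∀ q, ‖q‖ < ‖q₀‖ →
        (F q)⁻¹ = (deriv F q₀)⁻¹ * (1 / (q - q₀)) + (deriv F q₁)⁻¹ * (1 / (q - q₁)) + h q := by
  have h₁ : ‖q₁‖ < 1 := hmod ▸ h₀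
  obtain ⟨H, hH, hFH⟩ := exists_factor_two hF h₀ h₁ hne hz₀ hz₁
  have hHd : ∀ p : ℂ, ‖p‖ < 1 → DifferentiableAt ℂ H p := fun p hp =>
    hH.differentiableAt (Metric.isOpen_ball.mem_nhds (by simpa using hp))
  have hderiv : ∀ p : ℂ, ‖p‖ < 1 → deriv F p =
      ((p - q₁) + (p - q₀)) * H p + (p - q₀) * (p - q₁) * deriv H p := by
    intro p hp
    have e : F = fun q => (q - q₀) * (q - q₁) * H q := funext hFH
    rw [e]
    have := ((((hasDerivAt_id p).sub_const q₀).mul ((hasDerivAt_id p).sub_const q₁)).mul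
      (hHd p hp).hasDerivAt).deriv
    simp only [id] at this
    refine Eq.trans ?_ (this.trans ?_)
    · rfl
    · simp
  have hD₀ : deriv F q₀ = (q₀ - q₁) * H q₀ := by rw [hderiv _ h₀]; ring
  have hD₁ : deriv F q₁ = (q₁ - q₀) * H q₁ := by rw [hderiv _ h₁]; ring
  have hH₀ : H q₀ ≠ 0 := fun h => hd₀ (by rw [hD₀, h, mul_zero])
  have hH₁ : H q₁ ≠ 0 := fun h => hd₁ (by rw [hD₁, h, mul_zero])
  have hHne : ∀ q, ‖q‖ ≤ ‖q₀‖ → H q ≠ 0 := by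
    intro q hq h
    rcases hzeros q hq (by rw [hFH, h, mul_zero]) with rfl | rfl
    exacts [hH₀ h, hH₁ h]
  -- by compactness `H` stays non-zero on a slightly larger disc
  have hopen : IsOpen (Metric.ball (0 : ℂ) 1 ∩ H ⁻¹' {0}ᶜ) :=
    hH.continuousOn.isOpen_inter_preimage Metric.isOpen_ball isOpen_compl_singleton
  obtain ⟨δ, hδ, hsub⟩ := (isCompact_closedBall (0 : ℂ) ‖q₀‖).exists_thickening_subset_open hopen
    (fun q hq => by
      have hq' : ‖q‖ ≤ ‖q₀‖ := by simpa using hq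
      exact ⟨by simpa using hq'.trans_lt h₀, hHne q hq'⟩)
  rw [thickening_closedBall hδ (norm_nonneg _)] at hsub
  set R := δ + ‖q₀‖ with hR
  have hqR : ‖q₀‖ < R := by linarith
  set A := (deriv F q₀)⁻¹ with hA
  set B := (deriv F q₁)⁻¹ with hB
  have hN : DifferentiableOn ℂ (fun q => (H q)⁻¹ - A * (q - q₁) - B * (q - q₀))
      (Metric.ball 0 R) := by
    have h1 : DifferentiableOn ℂ (fun q => (H q)⁻¹) (Metric.ball 0 R) :=
      (hH.mono fun q hq => (hsub hq).1).inv fun q hq => (hsub hq).2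
    fun_prop
  obtain ⟨h, hh, hNh⟩ := exists_factor_two hN hqR (hmod ▸ hqR) hne
    (by
      simp only [sub_self, mul_zero, sub_zero, hA, hD₀]
      have := sub_ne_zero.2 hne
      field_simp
      ring)
    (by
      simp only [sub_self, mul_zero, sub_zero, hB, hD₁]
      have := sub_ne_zero.2 hne.symm
      field_simp
      ring)
  refine ⟨R, h, hqR, hh, fun q hq => ?_⟩
  have e₀ : q - q₀ ≠ 0 := fun h' => by rw [sub_eq_zero.1 h'] at hq; exact lt_irrefl _ hq
  have e₁ : q - q₁ ≠ 0 := fun h' => by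
    rw [sub_eq_zero.1 h', hmod] at hq; exact lt_irrefl _ hq
  have e₂ := hNh q
  have e₃ := hHne q hq.le
  rw [hFH, mul_inv, sub_eq_iff_eq_add, sub_eq_iff_eq_add] at *
  rw [e₂]
  field_simp
  ring

/-- Asymptotics of the coefficients of `1 / f` from the two dominant simple poles. -/
theorem reciprocal_coeff_tendsto {f : PowerSeries ℂ} {F : ℂ → ℂ} {q₀ q₁ : ℂ}
    (hF : DifferentiableOn ℂ F (Metric.ball 0 1))
    (hf : ∀ q : ℂ, ‖q‖ < 1 → HasSum (fun n => f.coeff n * q ^ n) (F q))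
    (hpos : q₀ ≠ 0) (h₀ : ‖q₀‖ < 1)
    (hmod : ‖q₁‖ = ‖q₀‖) (hne : q₀ ≠ q₁) (hz₀ : F q₀ = 0) (hz₁ : F q₁ = 0)
    (hzeros : ∀ q, ‖q‖ ≤ ‖q₀‖ → F q = 0 → q = q₀ ∨ q = q₁)
    (hd₀ : deriv F q₀ ≠ 0) (hd₁ : deriv F q₁ ≠ 0) :
    Filter.Tendsto (fun n : ℕ => f⁻¹.coeff n * q₀ ^ n + 1 / (q₀ * deriv F q₀)
      + 1 / (q₁ * deriv F q₁) * (q₀ / q₁) ^ n) Filter.atTop (nhds 0) := by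
  have hpos' : 0 < ‖q₀‖ := norm_pos_iff.2 hpos
  have hpos₁ : q₁ ≠ 0 := norm_pos_iff.1 (hmod ▸ hpos')
  obtain ⟨R, h, hR, hh, hdec⟩ := exists_reciprocal_sub_poles hF h₀ hmod hne hz₀ hz₁ hzeros hd₀ hd₁
  obtain ⟨c, hc⟩ := exists_hasSum_of_differentiableOn_ball hh
  have hcoeff := powerSeries_coeff_unique (a := fun n => f⁻¹.coeff n)
    (b := fun n => (deriv F q₀)⁻¹ * -(1 / q₀ ^ (n + 1)) + (deriv F q₁)⁻¹ * -(1 / q₁ ^ (n + 1)) + c n)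
    (F := fun q => (F q)⁻¹) hpos' (fun q hq => by
      refine reciprocal_hasSum hpos' (hF.mono (Metric.ball_subset_ball h₀.le))
        (fun q hq => hf q (hq.trans h₀)) (fun q hq h => ?_) hq
      rcases hzeros q hq.le h with rfl | rfl
      · exact lt_irrefl _ hq
      · exact hq.ne hmod) (fun q hq => by
      simp only [hdec q hq]
      have := (((hasSum_simple_pole hq).mul_left (deriv F q₀)⁻¹).add
        ((hasSum_simple_pole (hmod ▸ hq : ‖q‖ < ‖q₁‖)).mul_left (deriv F q₁)⁻¹)).add
        (hc q (hq.trans hR))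
      convert! this using 2 with n
      ring)
  have hlim := (hc q₀ hR).summable.tendsto_atTop_zero
  refine hlim.congr fun n => ?_
  rw [congrFun hcoeff n, div_pow]
  field_simp
  ring

/-- If the radius were larger, the identity `f * f⁻¹ = 1` could be evaluated at the zero `q₀`. -/
theorem reciprocal_radius {f : PowerSeries ℂ} {F : ℂ → ℂ} {q₀ : ℂ}
    (hF : DifferentiableOn ℂ F (Metric.ball 0 1))
    (hf : ∀ q : ℂ, ‖q‖ < 1 → HasSum (fun n => f.coeff n * q ^ n) (F q))
    (hpos : q₀ ≠ 0) (h₀ : ‖q₀‖ < 1) (hz₀ : F q₀ = 0)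
    (hzeros : ∀ q, ‖q‖ < ‖q₀‖ → F q ≠ 0) :
    (FormalMultilinearSeries.ofScalars ℂ fun n => f⁻¹.coeff n).radius = ENNReal.ofReal ‖q₀‖ := by
  have hpos' : 0 < ‖q₀‖ := norm_pos_iff.2 hpos
  have hnorm : ∀ n, ‖(FormalMultilinearSeries.ofScalars ℂ fun n => f⁻¹.coeff n) n‖ =
      ‖f⁻¹.coeff n‖ := fun n => by
    simp
  apply le_antisymm
  · by_contra! hlt
    have hlt' : ((‖q₀‖₊ : NNReal) : ENNReal) <
        (FormalMultilinearSeries.ofScalars ℂ fun n => f⁻¹.coeff n).radius := by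
      rwa [ofReal_norm] at hlt
    have hs := FormalMultilinearSeries.summable_norm_mul_pow _ hlt'
    simp only [hnorm, coe_nnnorm, ← norm_pow, ← norm_mul] at hs
    have hfne : PowerSeries.constantCoeff f ≠ 0 := by
      have h1 := (hf 0 (by simp)).tsum_eq
      rw [tsum_eq_single 0 (fun n hn => by simp [hn])] at h1
      have h2 := hzeros 0 (by simpa using hpos')
      rw [← h1] at h2
      simpa using h2
    have hm := powerSeries_hasSum_mul f f⁻¹ (hf q₀ h₀) hs.of_norm.hasSum
    rw [PowerSeries.mul_inv_cancel _ hfne, hz₀, zero_mul] at hm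
    have h1 : HasSum (fun n => (1 : PowerSeries ℂ).coeff n * q₀ ^ n) 1 :=
      powerSeries_hasSum_one q₀
    exact zero_ne_one (hm.unique h1)
  · refine le_of_forall_lt_imp_le_of_dense fun r hr => ?_
    lift r to NNReal using hr.ne_top
    have hr' : (r : ℝ) < ‖q₀‖ := by
      rw [ENNReal.lt_ofReal_iff_toReal_lt (by simp)] at hr
      simpa using hr
    apply FormalMultilinearSeries.le_radius_of_summable
    simp only [hnorm]
    have := (reciprocal_hasSum hpos' (hF.mono (Metric.ball_subset_ball h₀.le))
      (fun q hq => hf q (hq.trans h₀)) hzeros (q := (r : ℂ)) (by simpa using hr')).summable.norm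
    simpa using this

/-- `Θ` acts as `q d/dq` inside the disc of convergence. -/
theorem seriesValue_ramanujanTheta {f : PowerSeries ℂ} {F : ℂ → ℂ}
    (hf : ∀ q : ℂ, ‖q‖ < 1 → HasSum (fun n => f.coeff n * q ^ n) (F q)) {q : ℂ} (hq : ‖q‖ < 1) :
    seriesValue (ramanujanTheta f) q = q * deriv F q := by
  have hps : HasFPowerSeriesOnBall F (FormalMultilinearSeries.ofScalars ℂ fun n => f.coeff n) 0 1 := by
    refine ⟨?_, by simp, fun {y} hy => ?_⟩
    · refine le_of_forall_lt_imp_le_of_dense fun r hr => ?_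
      lift r to NNReal using hr.ne_top
      apply FormalMultilinearSeries.le_radius_of_summable
      have := (hf (r : ℂ) (by simpa using hr)).summable.norm
      simpa [FormalMultilinearSeries.ofScalars_norm] using this
    · have hy' : ‖y‖ < 1 := by
        rw [← ENNReal.coe_one, Metric.eball_coe] at hy
        simpa using hy
      simpa [mul_comm] using hf y hy'
  have hd := hps.fderiv.hasSum (y := q) (by rw [← ENNReal.coe_one, Metric.eball_coe]; simpa using hq)
  rw [zero_add] at hd
  have hd' := hd.mapL (ContinuousLinearMap.apply ℂ ℂ q)
  simp only [ContinuousLinearMap.apply_apply, FormalMultilinearSeries.derivSeries_apply_diag,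
    fderiv_eq_smul_deriv] at hd'
  have h1 : HasSum (fun n : ℕ => (ramanujanTheta f).coeff (n + 1) * q ^ (n + 1)) (q * deriv F q) := by
    convert! hd' using 2 with n
    simp only [ramanujanTheta, PowerSeries.coeff_mk, FormalMultilinearSeries.ofScalars_apply_eq,
      nsmul_eq_mul, smul_eq_mul]
    push_cast
    ring
  rw [hasSum_nat_add_iff (f := fun n : ℕ => (ramanujanTheta f).coeff n * q ^ n) 1] at h1
  simpa [ramanujanTheta, seriesValue] using h1.tsum_eq

/-! ### Bounds for the lattice sum -/

open Classical in
/-- The term `(c z + d)^{-k}` of the Eisenstein series, for coprime `c`, `d` both different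
from `0`; all other pairs contribute `0`. -/
noncomputable def mixedTerm (k : ℕ) (p : ℤ × ℤ) (z : ℂ) : ℂ :=
  if p.1 ≠ 0 ∧ p.2 ≠ 0 ∧ IsCoprime p.1 p.2 then (((p.1 : ℂ) * z + p.2) ^ k)⁻¹ else 0

/-- What is left of `E_k(z)` after removing the terms `1` and `z^{-k}`. -/
noncomputable def eisRemainder (k : ℕ) (z : ℂ) : ℂ := (1 / 2) * ∑' p : ℤ × ℤ, mixedTerm k p z

/-- A summable majorant of the terms `(c z + d)^{-12}` with `c d ≠ 0`: the four pairs
`±(1, -1)`, `±(1, 1)` get the values `A` and `1 / 64`, every other pair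
gets `1 / (81 c² d²)`, which is `0` when `c d = 0` by the convention `1 / 0 = 0`. -/
noncomputable def majorant (A : ℝ) (p : ℤ × ℤ) : ℝ :=
  1 / 81 * (1 / (p.1 : ℝ) ^ 2 * (1 / (p.2 : ℝ) ^ 2))
    + ((if p = (1, -1) then A - 1 / 81 else 0) + (if p = (-1, 1) then A - 1 / 81 else 0))
    + ((if p = (1, 1) then 1 / 64 - 1 / 81 else 0)
      + (if p = (-1, -1) then 1 / 64 - 1 / 81 else 0))

theorem hasSum_int_one_div_sq : HasSum (fun n : ℤ => 1 / (n : ℝ) ^ 2) (Real.pi ^ 2 / 3) := by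
  have h := HasSum.of_nat_of_neg (f := fun n : ℤ => 1 / (n : ℝ) ^ 2)
    (by simpa using hasSum_zeta_two) (by simpa using hasSum_zeta_two)
  convert! h using 1
  simp only [Int.cast_zero]
  norm_num
  ring

theorem hasSum_majorant (A : ℝ) : HasSum (majorant A)
    (1 / 81 * (Real.pi ^ 2 / 3 * (Real.pi ^ 2 / 3)) + ((A - 1 / 81) + (A - 1 / 81))
      + ((1 / 64 - 1 / 81) + (1 / 64 - 1 / 81))) := by
  have h := hasSum_int_one_div_sq
  have hs := h.summable.mul_of_nonneg h.summable (fun n => by positivity) (fun n => by positivity)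
  exact (((h.mul h hs).mul_left (1 / 81)).add
    ((hasSum_ite_eq _ _).add (hasSum_ite_eq _ _))).add
    ((hasSum_ite_eq _ _).add (hasSum_ite_eq _ _))

theorem tsum_majorant_le (A : ℝ) : ∑' p, majorant A p ≤ 2 * A + 0.116 := by
  rw [(hasSum_majorant A).tsum_eq]
  have h1 := Real.pi_lt_d4
  have h2 := Real.pi_pos
  have h3 : Real.pi ^ 2 ≤ 9.87 := by nlinarith
  nlinarith [sq_nonneg (Real.pi ^ 2), sq_nonneg Real.pi]

/-- Away from `|c| = |d| = 1`, the quadratic form bounding `|c z + d|²` from below is at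
least `3`. -/
theorem int_sq_add_sq_sub_abs_mul_ge {c d : ℤ} (hc : c ≠ 0) (hd : d ≠ 0)
    (h : 2 ≤ |c| ∨ 2 ≤ |d|) : 3 ≤ c ^ 2 + d ^ 2 - |c * d| := by
  have h1 := Int.one_le_abs hc
  have h2 := Int.one_le_abs hd
  rw [abs_mul, ← sq_abs c, ← sq_abs d]
  generalize |c| = a at *
  generalize |d| = b at *
  rcases h with h | h
  · nlinarith [sq_nonneg (2 * b - a)]
  · nlinarith [sq_nonneg (2 * a - b)]

theorem normSq_linear (c d : ℝ) (z : ℂ) : Complex.normSq (c * z + d) =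
    c ^ 2 * Complex.normSq z + 2 * (c * d) * z.re + d ^ 2 := by
  simp only [Complex.normSq_apply, Complex.add_re, Complex.mul_re, Complex.ofReal_re,
    Complex.ofReal_im, Complex.add_im, Complex.mul_im]
  ring

/-- In the right half of the fundamental domain `|c z + d|²` is at least `c² + d² - |c d|`, which
for `c d ≤ 0` is its value at the corner `e^{iπ/3}`. -/
theorem normSq_linear_ge {c d : ℤ} {z : ℂ} (hz : 1 ≤ Complex.normSq z) (hx : 0 ≤ z.re)
    (hx' : z.re ≤ 1 / 2) :
    ((c ^ 2 + d ^ 2 - |c * d| : ℤ) : ℝ) ≤ Complex.normSq ((c : ℂ) * z + d) := by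
  have h := normSq_linear c d z
  simp only [Complex.ofReal_intCast] at h
  rw [h]
  push_cast
  have h1 : (c : ℝ) ^ 2 ≤ (c : ℝ) ^ 2 * Complex.normSq z := le_mul_of_one_le_right (sq_nonneg _) hz
  have h2 : -|(c : ℝ) * d| ≤ 2 * (c * d) * z.re := by
    have := abs_nonneg ((c : ℝ) * d)
    nlinarith [neg_abs_le ((c : ℝ) * d), le_abs_self ((c : ℝ) * d)]
  linarith

/-- The exponent `12` is split off; the remaining `2 j` factors give geometric decay in the
weight. -/
theorem norm_pow_inv_le {w : ℂ} {C m : ℝ} {j : ℕ} (hC : 1 ≤ C) (hCw : C ≤ Complex.normSq w)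
    (hm : (Complex.normSq w ^ 6)⁻¹ ≤ m) : ‖(w ^ (12 + 2 * j))⁻¹‖ ≤ (C ^ j)⁻¹ * m := by
  have h0 : 0 < Complex.normSq w := by linarith
  have : ‖(w ^ (12 + 2 * j))⁻¹‖ = (Complex.normSq w ^ j)⁻¹ * (Complex.normSq w ^ 6)⁻¹ := by
    rw [norm_inv, norm_pow, Complex.normSq_eq_norm_sq, ← mul_inv]
    congr 1
    ring
  rw [this]
  gcongr

/-- Outside the unit disc and in the right half of the strip, `normSq (z - 1) ≥ B` controls all the
terms of the remainder. -/
theorem norm_mixedTerm_le {z : ℂ} {B C : ℝ} {j : ℕ} (hz : 1 ≤ Complex.normSq z) (hx : 0 ≤ z.re)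
    (hx' : z.re ≤ 1 / 2) (hC : 1 ≤ C) (hC2 : C ≤ 2) (hCB : C ≤ B)
    (hB : B ≤ Complex.normSq (z - 1)) (p : ℤ × ℤ) :
    ‖mixedTerm (12 + 2 * j) p z‖ ≤ (C ^ j)⁻¹ * majorant (B ^ 6)⁻¹ p := by
  have hB0 : 0 < B := by linarith
  obtain ⟨c, d⟩ := p
  by_cases h : c ≠ 0 ∧ d ≠ 0 ∧ IsCoprime c d
  swap
  · rw [mixedTerm, if_neg h, norm_zero]
    have h0 : c = 0 ∨ d = 0 ∨ ¬ IsCoprime c d := by tauto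
    have hne : ¬ (((c, d) : ℤ × ℤ) = (1, -1)) ∧ ¬ (((c, d) : ℤ × ℤ) = (-1, 1)) ∧
        ¬ (((c, d) : ℤ × ℤ) = (1, 1)) ∧ ¬ (((c, d) : ℤ × ℤ) = (-1, -1)) := by
      simp only [Prod.mk.injEq]
      refine ⟨?_, ?_, ?_, ?_⟩ <;> rintro ⟨rfl, rfl⟩ <;> revert h0 <;> simp [isCoprime_one_left, IsCoprime.neg_left_iff]
    have : 0 ≤ majorant (B ^ 6)⁻¹ (c, d) := by
      rw [majorant, if_neg hne.1, if_neg hne.2.1, if_neg hne.2.2.1, if_neg hne.2.2.2]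
      positivity
    positivity
  · rw [mixedTerm, if_pos h]
    obtain ⟨hc, hd, -⟩ := h
    by_cases hlarge : 2 ≤ |c| ∨ 2 ≤ |d|
    · have h3 := int_sq_add_sq_sub_abs_mul_ge hc hd hlarge
      have hN := normSq_linear_ge (c := c) (d := d) hz hx hx'
      set n : ℤ := c ^ 2 + d ^ 2 - |c * d| with hn
      have h3' : (3 : ℝ) ≤ n := by exact_mod_cast h3
      have hcd : |c * d| ≤ n := by
        rw [hn, abs_mul, ← sq_abs c, ← sq_abs d]
        nlinarith [sq_nonneg (|c| - |d|)]
      have hcd' : |(c : ℝ) * d| ≤ n := by exact_mod_cast hcd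
      refine norm_pow_inv_le hC (by linarith) ?_
      have hne : ¬ (((c, d) : ℤ × ℤ) = (1, -1)) ∧ ¬ (((c, d) : ℤ × ℤ) = (-1, 1)) ∧
          ¬ (((c, d) : ℤ × ℤ) = (1, 1)) ∧ ¬ (((c, d) : ℤ × ℤ) = (-1, -1)) := by
        simp only [Prod.mk.injEq]
        refine ⟨?_, ?_, ?_, ?_⟩ <;> rintro ⟨rfl, rfl⟩ <;> revert hlarge <;> simp
      rw [majorant, if_neg hne.1, if_neg hne.2.1, if_neg hne.2.2.1, if_neg hne.2.2.2]
      have hc' : (0 : ℝ) < (c : ℝ) ^ 2 := by positivity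
      have hd' : (0 : ℝ) < (d : ℝ) ^ 2 := by positivity
      have key : 81 * ((c : ℝ) ^ 2 * (d : ℝ) ^ 2) ≤ Complex.normSq ((c : ℂ) * z + d) ^ 6 := by
        calc 81 * ((c : ℝ) ^ 2 * (d : ℝ) ^ 2) = 3 ^ 4 * |(c : ℝ) * d| ^ 2 := by
              rw [sq_abs]; ring
          _ ≤ (n : ℝ) ^ 4 * (n : ℝ) ^ 2 := by gcongr
          _ = (n : ℝ) ^ 6 := by ring
          _ ≤ _ := by gcongr
      calc (Complex.normSq ((c : ℂ) * z + d) ^ 6)⁻¹ ≤ (81 * ((c : ℝ) ^ 2 * (d : ℝ) ^ 2))⁻¹ := by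
            gcongr
        _ = _ := by simp only [add_zero]; field_simp
    · push Not at hlarge
      have hc1 : c = 1 ∨ c = -1 := by have := abs_lt.1 hlarge.1; omega
      have hd1 : d = 1 ∨ d = -1 := by have := abs_lt.1 hlarge.2; omega
      have hplus : (2 : ℝ) ≤ Complex.normSq (z + 1) := by
        have := normSq_linear 1 1 z
        simp only [Complex.ofReal_one, one_mul] at this
        rw [this]; nlinarith
      have e1 : Complex.normSq (-z + 1) = Complex.normSq (z - 1) := by
        rw [← Complex.normSq_neg]; congr 1; ring
      have e2 : Complex.normSq (-z - 1) = Complex.normSq (z + 1) := by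
        rw [← Complex.normSq_neg]; congr 1; ring
      have b1 : (Complex.normSq (z - 1) ^ 6)⁻¹ ≤ (B ^ 6)⁻¹ := by gcongr
      have b2 : (Complex.normSq (z + 1) ^ 6)⁻¹ ≤ 1 / 64 := by
        calc (Complex.normSq (z + 1) ^ 6)⁻¹ ≤ ((2 : ℝ) ^ 6)⁻¹ := by gcongr
          _ = 1 / 64 := by norm_num
      rcases hc1 with rfl | rfl <;> rcases hd1 with rfl | rfl <;>
        refine norm_pow_inv_le hC ?_ ?_ <;>
        simp [majorant, e1, e2, ← sub_eq_add_neg] <;> linarith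

theorem summable_mixedTerm {z : ℂ} {j : ℕ} (hz : 1 ≤ Complex.normSq z) (hx : 0 ≤ z.re)
    (hx' : z.re ≤ 1 / 2) (hB : 1 ≤ Complex.normSq (z - 1)) :
    Summable fun p => mixedTerm (12 + 2 * j) p z :=
  Summable.of_norm_bounded ((hasSum_majorant _).summable.mul_left _)
    (norm_mixedTerm_le hz hx hx' le_rfl one_le_two le_rfl hB)

theorem norm_eisRemainder_le {z : ℂ} {B C : ℝ} {j : ℕ} (hz : 1 ≤ Complex.normSq z) (hx : 0 ≤ z.re)
    (hx' : z.re ≤ 1 / 2) (hC : 1 ≤ C) (hC2 : C ≤ 2) (hCB : C ≤ B)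
    (hB : B ≤ Complex.normSq (z - 1)) :
    ‖eisRemainder (12 + 2 * j) z‖ ≤ (C ^ j)⁻¹ * ((B ^ 6)⁻¹ + 0.058) := by
  have h := tsum_of_norm_bounded ((hasSum_majorant (B ^ 6)⁻¹).summable.hasSum.mul_left _)
    (norm_mixedTerm_le (j := j) hz hx hx' hC hC2 hCB hB)
  have h2 := tsum_majorant_le (B ^ 6)⁻¹
  have h3 : 0 ≤ (C ^ j)⁻¹ := by positivity
  rw [eisRemainder, norm_mul]
  norm_num at h ⊢
  nlinarith

theorem E_eq_one_add_inv_pow_add_eisRemainder {k : ℕ} (hk : 3 ≤ k) (hk2 : Even k)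
    (z : UpperHalfPlane) (hs : Summable fun p => mixedTerm k p z) :
    ModularForm.E hk z = 1 + ((z : ℂ) ^ k)⁻¹ + eisRemainder k z := by
  classical
  have hE : ModularForm.E hk z =
      (1 / 2 : ℂ) * ∑' v : EisensteinSeries.gammaSet 1 1 0, EisensteinSeries.eisSummand k v z := rfl
  rw [hE, tsum_subtype (EisensteinSeries.gammaSet 1 1 0)
    (fun v => EisensteinSeries.eisSummand k v z), ← (finTwoArrowEquiv ℤ).symm.tsum_eq]
  have hterm : ∀ p : ℤ × ℤ, (EisensteinSeries.gammaSet 1 1 0).indicator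
      (fun v => EisensteinSeries.eisSummand k v z) ((finTwoArrowEquiv ℤ).symm p) =
      mixedTerm k p z + (((if p = (0, 1) then 1 else 0) + (if p = (0, -1) then 1 else 0))
        + ((if p = (1, 0) then ((z : ℂ) ^ k)⁻¹ else 0)
          + (if p = (-1, 0) then ((z : ℂ) ^ k)⁻¹ else 0))) := by
    rintro ⟨c, d⟩
    simp only [Set.indicator_apply, EisensteinSeries.mem_gammaSet_one, finTwoArrowEquiv_symm_apply,
      Matrix.cons_val_zero, Matrix.cons_val_one, EisensteinSeries.eisSummand, mixedTerm,
      Prod.mk.injEq, zpow_neg, zpow_natCast]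
    by_cases hc : c = 0
    · subst hc
      simp only [isCoprime_zero_left, Int.isUnit_iff]
      by_cases h1 : d = 1
      · subst h1; simp
      · by_cases h2 : d = -1
        · subst h2; simp [hk2.neg_one_pow]
        · simp [h1, h2]
    · by_cases hd : d = 0
      · subst hd
        simp only [isCoprime_zero_right, Int.isUnit_iff]
        by_cases h1 : c = 1
        · subst h1; simp
        · by_cases h2 : c = -1
          · subst h2; simp [hk2.neg_pow]
          · simp [h1, h2]
      · simp [hc, hd]
  have hsum := hs.hasSum.add (((hasSum_ite_eq ((0 : ℤ), (1 : ℤ)) (1 : ℂ)).add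
    (hasSum_ite_eq ((0 : ℤ), (-1 : ℤ)) (1 : ℂ))).add
    ((hasSum_ite_eq ((1 : ℤ), (0 : ℤ)) ((z : ℂ) ^ k)⁻¹).add
    (hasSum_ite_eq ((-1 : ℤ), (0 : ℤ)) ((z : ℂ) ^ k)⁻¹)))
  simp_rw [hterm]
  rw [hsum.tsum_eq, eisRemainder]
  ring

/-! ### The coordinate along the unit circle -/

open Complex in
/-- The coordinate `w` near the point `i`: `z = i e^{-iπw/k}`. Real `w` correspond to the unit
circle, and for `4 ∣ k` one has `z^{-k} = e^{iπw}`. -/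
noncomputable def arcPoint (k : ℕ) (w : ℂ) : ℂ := I * exp (-(I * Real.pi * w / k))

/-- The rectangle of coordinates around `w = 1` that contains the coordinate of the highest zero. -/
def arcBox : Set ℂ := {w | 5 / 6 ≤ w.re ∧ w.re ≤ 7 / 6 ∧ 0 ≤ w.im ∧ w.im ≤ 1 / 4}

/-- The Eisenstein series in the coordinate `w`. -/
noncomputable def arcEisenstein (k : ℕ) (w : ℂ) : ℂ :=
  1 + Complex.exp (Complex.I * Real.pi * w) + eisRemainder k (arcPoint k w)

theorem arcPoint_re (k : ℕ) (w : ℂ) :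
    (arcPoint k w).re = Real.exp (Real.pi * w.im / k) * Real.sin (Real.pi * w.re / k) := by
  have h : -(Complex.I * Real.pi * w / k) =
      ((Real.pi * w.im / k : ℝ) : ℂ) + ((-(Real.pi * w.re / k) : ℝ) : ℂ) * Complex.I := by
    conv_lhs => rw [← Complex.re_add_im w]
    push_cast
    linear_combination (-(Real.pi : ℂ) * w.im / k) * Complex.I_mul_I
  rw [arcPoint, h, Complex.I_mul_re, Complex.exp_im]
  simp

theorem arcPoint_im (k : ℕ) (w : ℂ) :
    (arcPoint k w).im = Real.exp (Real.pi * w.im / k) * Real.cos (Real.pi * w.re / k) := by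
  have h : -(Complex.I * Real.pi * w / k) =
      ((Real.pi * w.im / k : ℝ) : ℂ) + ((-(Real.pi * w.re / k) : ℝ) : ℂ) * Complex.I := by
    conv_lhs => rw [← Complex.re_add_im w]
    push_cast
    linear_combination (-(Real.pi : ℂ) * w.im / k) * Complex.I_mul_I
  rw [arcPoint, h, Complex.I_mul_im, Complex.exp_re]
  simp

theorem arcPoint_normSq (k : ℕ) (w : ℂ) :
    Complex.normSq (arcPoint k w) = Real.exp (Real.pi * w.im / k) ^ 2 := by
  rw [Complex.normSq_apply, arcPoint_re, arcPoint_im]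
  linear_combination Real.exp (Real.pi * w.im / k) ^ 2 * Real.sin_sq_add_cos_sq (Real.pi * w.re / k)

/-- Here `4 ∣ k` is used, through `i^k = 1`. -/
theorem arcPoint_inv_pow {k : ℕ} (hk : 0 < k) (hk4 : k % 4 = 0) (w : ℂ) :
    ((arcPoint k w) ^ k)⁻¹ = Complex.exp (Complex.I * Real.pi * w) := by
  have hI : Complex.I ^ k = 1 := by
    rw [← Nat.div_add_mod k 4, hk4, add_zero, pow_mul, Complex.I_pow_four, one_pow]
  have hk' : (k : ℂ) ≠ 0 := by exact_mod_cast hk.ne'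
  rw [arcPoint, mul_pow, hI, one_mul, ← Complex.exp_nat_mul, ← Complex.exp_neg]
  congr 1
  field_simp

/-- Every point with `|z| ≥ 1` and `Re z ≥ 0` has a coordinate `w` with `Re w ≥ 0`, `Im w ≥ 0`. -/
theorem exists_arcPoint_eq {k : ℕ} (hk : 0 < k) {z : ℂ} (hz : 1 ≤ Complex.normSq z) (hx : 0 ≤ z.re)
    (hy : 0 < z.im) :
    ∃ w : ℂ, arcPoint k w = z ∧ 0 ≤ w.re ∧ Real.pi * w.re / k ≤ Real.pi / 2 ∧ 0 ≤ w.im := by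
  have hk' : (k : ℂ) ≠ 0 := by exact_mod_cast hk.ne'
  have hk0 : (0 : ℝ) < k := by exact_mod_cast hk
  have hpi := Real.pi_pos
  have hpi' : (Real.pi : ℂ) ≠ 0 := by exact_mod_cast hpi.ne'
  set u : ℂ := -(Complex.I * z) with hu
  have hu0 : u ≠ 0 := by
    intro h
    have := congrArg Complex.re h
    simp [hu] at this
    exact hy.ne' this
  have hure : u.re = z.im := by simp [hu]
  have huim : u.im = -z.re := by simp [hu]
  have hunorm : 1 ≤ ‖u‖ := by
    rw [← one_le_sq_iff₀ (norm_nonneg _), ← Complex.normSq_eq_norm_sq, hu]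
    simpa using hz
  have harg : u.arg ≤ 0 := by
    rcases hx.eq_or_lt with h | h
    · rw [Complex.arg_eq_zero_iff.2 ⟨by rw [hure]; exact hy.le, by rw [huim, ← h, neg_zero]⟩]
    · exact (Complex.arg_neg_iff.2 (by rw [huim]; linarith)).le
  have harg2 : -(Real.pi / 2) ≤ u.arg :=
    (abs_le.1 (Complex.abs_arg_le_pi_div_two_iff.2 (by rw [hure]; exact hy.le))).1
  have hre : (Complex.I * ((k / Real.pi : ℝ) * Complex.log u)).re = -(k / Real.pi * u.arg) := by
    rw [Complex.I_mul_re, Complex.im_ofReal_mul, Complex.log_im]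
  have him : (Complex.I * ((k / Real.pi : ℝ) * Complex.log u)).im = k / Real.pi * Real.log ‖u‖ := by
    rw [Complex.I_mul_im, Complex.re_ofReal_mul, Complex.log_re]
  refine ⟨Complex.I * ((k / Real.pi : ℝ) * Complex.log u), ?_, ?_, ?_, ?_⟩
  · have : -(Complex.I * Real.pi * (Complex.I * ((k / Real.pi : ℝ) * Complex.log u)) / k) =
        Complex.log u := by
      push_cast
      field_simp
      linear_combination (-Complex.log u) * Complex.I_sq
    rw [arcPoint, this, Complex.exp_log hu0, hu]
    linear_combination (-z) * Complex.I_mul_I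
  · rw [hre]
    have : 0 ≤ k / Real.pi * (-u.arg) := mul_nonneg (by positivity) (by linarith)
    linarith
  · rw [hre]
    have : Real.pi * -(k / Real.pi * u.arg) / k = -u.arg := by field_simp
    rw [this]; linarith
  · rw [him]
    exact mul_nonneg (by positivity) (Real.log_nonneg hunorm)

theorem pi_mul_div_le {k : ℕ} (hk : 12 ≤ k) {t : ℝ} (ht : 0 ≤ t) :
    Real.pi * t / k ≤ 0.2618 * t := by
  have hk' : (12 : ℝ) ≤ k := by exact_mod_cast hk
  have h1 : Real.pi * t / k ≤ Real.pi * t / 12 := by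
    have := Real.pi_pos
    gcongr
  have h2 := Real.pi_lt_d4
  nlinarith

/-- The position of the points with coordinates in `arcBox`. -/
theorem arcPoint_bounds {k : ℕ} (hk : 12 ≤ k) {w : ℂ} (hw : w ∈ arcBox) :
    1 ≤ Complex.normSq (arcPoint k w) ∧ 0 ≤ (arcPoint k w).re ∧ (arcPoint k w).re ≤ 0.45 ∧
      0.953 * ‖arcPoint k w‖ ≤ (arcPoint k w).im ∧
      1.388 ≤ Complex.normSq (arcPoint k w - 1) := by
  obtain ⟨h1, h2, h3, h4⟩ := hw
  have hk0 : (0 : ℝ) < k := by have : 0 < k := by omega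
                               exact_mod_cast this
  have hpi := Real.pi_pos
  have hθ : Real.pi * w.re / k ≤ 0.2618 * w.re := pi_mul_div_le hk (by linarith)
  have hθ0 : 0 ≤ Real.pi * w.re / k := by positivity
  have hb : Real.pi * w.im / k ≤ 0.2618 * w.im := pi_mul_div_le hk h3
  have hb0 : 0 ≤ Real.pi * w.im / k := by positivity
  have hre := arcPoint_re k w
  have him := arcPoint_im k w
  have hns := arcPoint_normSq k w
  have hnorm : ‖arcPoint k w‖ = Real.exp (Real.pi * w.im / k) := by
    rw [Complex.normSq_eq_norm_sq] at hns
    exact (pow_left_inj₀ (norm_nonneg _) (Real.exp_pos _).le two_ne_zero).1 hns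
  have hE1 : 1 ≤ Real.exp (Real.pi * w.im / k) := Real.one_le_exp hb0
  have hE2 : Real.exp (Real.pi * w.im / k) ≤ 1.2 := by
    have := Real.exp_bound_div_one_sub_of_interval hb0 (by linarith)
    refine this.trans ?_
    rw [div_le_iff₀ (by linarith)]
    linarith
  have hs0 : 0 ≤ Real.sin (Real.pi * w.re / k) :=
    Real.sin_nonneg_of_nonneg_of_le_pi hθ0 (by linarith [Real.pi_gt_three])
  have hs1 : Real.sin (Real.pi * w.re / k) ≤ 0.30544 :=
    (Real.sin_le hθ0).trans (by linarith)
  have hc : 0.953 ≤ Real.cos (Real.pi * w.re / k) := by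
    have := Real.one_sub_sq_div_two_le_cos (x := Real.pi * w.re / k)
    have : Real.pi * w.re / k ≤ 0.3055 := by linarith
    nlinarith
  have hsub : Complex.normSq (arcPoint k w - 1) =
      Complex.normSq (arcPoint k w) + 1 - 2 * (arcPoint k w).re := by
    simp only [Complex.normSq_apply, Complex.sub_re, Complex.sub_im, Complex.one_re, Complex.one_im]
    ring
  rw [hsub, hns, hnorm, hre, him]
  generalize Real.exp (Real.pi * w.im / k) = e at *
  generalize Real.sin (Real.pi * w.re / k) = s at *
  refine ⟨by nlinarith, by positivity, by nlinarith, by nlinarith, by nlinarith⟩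

theorem convex_arcBox : Convex ℝ arcBox := by
  have : arcBox = Complex.reLm ⁻¹' Set.Icc (5 / 6 : ℝ) (7 / 6) ∩ Complex.imLm ⁻¹' Set.Icc 0 (1 / 4) := by
    ext w
    simp [arcBox, and_assoc]
  rw [this]
  exact ((convex_Icc _ _).linear_preimage _).inter ((convex_Icc _ _).linear_preimage _)

theorem norm_arcRemainder_le {j : ℕ} {w : ℂ} (hw : w ∈ arcBox) :
    ‖eisRemainder (12 + 2 * j) (arcPoint (12 + 2 * j) w)‖ ≤ 0.2 := by
  obtain ⟨h1, h2, h3, h4, h5⟩ := arcPoint_bounds (k := 12 + 2 * j) (by omega) hw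
  have := norm_eisRemainder_le (j := j) h1 h2 (by linarith) le_rfl one_le_two (by norm_num) h5
  rw [one_pow, inv_one, one_mul] at this
  exact this.trans (by norm_num)

theorem hasDerivAt_arcPoint (k : ℕ) (w : ℂ) :
    HasDerivAt (arcPoint k) (-(Complex.I * Real.pi / k) * arcPoint k w) w := by
  have h : HasDerivAt (fun w : ℂ => -(Complex.I * Real.pi * w / k)) (-(Complex.I * Real.pi / k)) w := by
    have := (((hasDerivAt_id w).const_mul (Complex.I * Real.pi)).div_const (k : ℂ)).neg
    simpa using! this
  have h2 := (h.cexp).const_mul Complex.I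
  refine h2.congr_deriv ?_
  rw [arcPoint]; ring

/-- Each term of the remainder is Lipschitz on `arcBox` with a constant proportional to its
majorant: the factor `k` coming from the exponent cancels against `dz/dw = -iπz/k`. -/
theorem norm_mixedTerm_sub_le {j : ℕ} {w w₀ : ℂ} (hw : w ∈ arcBox) (hw₀ : w₀ ∈ arcBox)
    (p : ℤ × ℤ) :
    ‖mixedTerm (12 + 2 * j) p (arcPoint (12 + 2 * j) w)
      - mixedTerm (12 + 2 * j) p (arcPoint (12 + 2 * j) w₀)‖ ≤
      Real.pi / 0.953 * majorant ((1.388 : ℝ) ^ 6)⁻¹ p * ‖w - w₀‖ := by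
  set k := 12 + 2 * j with hk
  have hk0 : (k : ℂ) ≠ 0 := by
    have : k ≠ 0 := by omega
    exact_mod_cast this
  have hM : ∀ w ∈ arcBox, ‖mixedTerm k p (arcPoint k w)‖ ≤ majorant ((1.388 : ℝ) ^ 6)⁻¹ p := by
    intro w hw
    obtain ⟨h1, h2, h3, h4, h5⟩ := arcPoint_bounds (k := k) (by omega) hw
    have := norm_mixedTerm_le (j := j) h1 h2 (by linarith) le_rfl one_le_two (by norm_num) h5 p
    rwa [one_pow, inv_one, one_mul] at this
  by_cases hp : p.1 ≠ 0 ∧ p.2 ≠ 0 ∧ IsCoprime p.1 p.2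
  swap
  · have h0 : ∀ z, mixedTerm k p z = 0 := fun z => by rw [mixedTerm, if_neg hp]
    rw [h0, h0, sub_self, norm_zero]
    have := (norm_nonneg _).trans (hM w hw)
    have := Real.pi_pos
    positivity
  have hterm : ∀ z, mixedTerm k p z = (((p.1 : ℂ) * z + p.2) ^ k)⁻¹ := fun z => by
    rw [mixedTerm, if_pos hp]
  have hc0 : (0 : ℝ) < |(p.1 : ℝ)| := abs_pos.2 (by exact_mod_cast hp.1)
  have himage : ∀ w ∈ arcBox,
      0.953 * ‖(p.1 : ℂ) * arcPoint k w‖ ≤ ‖(p.1 : ℂ) * arcPoint k w + p.2‖ := by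
    intro w hw
    obtain ⟨h1, h2, h3, h4, h5⟩ := arcPoint_bounds (k := k) (by omega) hw
    have e1 : ((p.1 : ℂ) * arcPoint k w + p.2).im = p.1 * (arcPoint k w).im := by simp
    have e2 := Complex.abs_im_le_norm ((p.1 : ℂ) * arcPoint k w + p.2)
    rw [e1, abs_mul] at e2
    rw [norm_mul, Complex.norm_intCast]
    calc _ = |(p.1 : ℝ)| * (0.953 * ‖arcPoint k w‖) := by ring
      _ ≤ |(p.1 : ℝ)| * |(arcPoint k w).im| := by gcongr; exact h4.trans (le_abs_self _)
      _ ≤ _ := e2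
  have hzpos : ∀ w, arcPoint k w ≠ 0 := fun w => by
    rw [arcPoint]; exact mul_ne_zero Complex.I_ne_zero (Complex.exp_ne_zero _)
  have hcz : ∀ w, 0 < ‖(p.1 : ℂ) * arcPoint k w‖ := fun w =>
    norm_pos_iff.2 (mul_ne_zero (by exact_mod_cast hp.1) (hzpos w))
  have hlin : ∀ w ∈ arcBox, (p.1 : ℂ) * arcPoint k w + p.2 ≠ 0 := fun w hw h => by
    have h1 := himage w hw
    have h2 := hcz w
    rw [h, norm_zero] at h1
    linarith
  refine convex_arcBox.norm_image_sub_le_of_norm_hasDerivWithin_le (𝕜 := ℂ)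
    (f := fun w => mixedTerm k p (arcPoint k w))
    (f' := fun w => Complex.I * Real.pi * ((p.1 : ℂ) * arcPoint k w)
      / ((p.1 : ℂ) * arcPoint k w + p.2) * mixedTerm k p (arcPoint k w)) ?_ ?_ hw₀ hw
  · intro w hw
    have h1 := (((((hasDerivAt_arcPoint k w).const_mul (p.1 : ℂ)).add_const (p.2 : ℂ)).pow k).inv
      (pow_ne_zero k (hlin w hw))).hasDerivWithinAt (s := arcBox)
    have e : (fun w => mixedTerm k p (arcPoint k w)) =
        (((fun w => (p.1 : ℂ) * arcPoint k w + p.2) ^ k)⁻¹ : ℂ → ℂ) := by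
      ext w; simp [hterm]
    rw [e]
    refine h1.congr_deriv ?_
    rw [hterm]
    have h2 := hlin w hw
    have hpow : ((p.1 : ℂ) * arcPoint k w + p.2) ^ k =
        ((p.1 : ℂ) * arcPoint k w + p.2) ^ (k - 1) * ((p.1 : ℂ) * arcPoint k w + p.2) := by
      rw [← pow_succ]; congr 1; omega
    simp only [Pi.pow_apply]
    rw [hpow]
    field_simp
  · intro w hw
    rw [norm_mul, norm_div, norm_mul, norm_mul, Complex.norm_I, one_mul, Complex.norm_real,
      Real.norm_eq_abs, abs_of_pos Real.pi_pos]
    have h1 := himage w hw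
    have h2 := hcz w
    have h3 : 0 < ‖(p.1 : ℂ) * arcPoint k w + p.2‖ := norm_pos_iff.2 (hlin w hw)
    have hpi := Real.pi_pos
    refine mul_le_mul ?_ (hM w hw) (norm_nonneg _) (by positivity)
    rw [div_le_div_iff₀ h3 (by norm_num)]
    nlinarith

theorem norm_arcRemainder_sub_le {j : ℕ} {w w₀ : ℂ} (hw : w ∈ arcBox) (hw₀ : w₀ ∈ arcBox) :
    ‖eisRemainder (12 + 2 * j) (arcPoint (12 + 2 * j) w)
      - eisRemainder (12 + 2 * j) (arcPoint (12 + 2 * j) w₀)‖ ≤ 0.21 * Real.pi * ‖w - w₀‖ := by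
  have hs : ∀ w ∈ arcBox, Summable fun p =>
      mixedTerm (12 + 2 * j) p (arcPoint (12 + 2 * j) w) := by
    intro w hw
    obtain ⟨h1, h2, h3, h4, h5⟩ := arcPoint_bounds (k := 12 + 2 * j) (by omega) hw
    exact summable_mixedTerm h1 h2 (by linarith) (by linarith)
  have h := tsum_of_norm_bounded
    (((hasSum_majorant ((1.388 : ℝ) ^ 6)⁻¹).summable.hasSum.mul_left
      (Real.pi / 0.953)).mul_right ‖w - w₀‖)
    (norm_mixedTerm_sub_le (j := j) hw hw₀)
  rw [(hs w hw).tsum_sub (hs w₀ hw₀)] at h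
  rw [eisRemainder, eisRemainder, ← mul_sub, norm_mul]
  have h1 := tsum_majorant_le ((1.388 : ℝ) ^ 6)⁻¹
  have h2 : 2 * ((1.388 : ℝ) ^ 6)⁻¹ + 0.116 ≤ 0.4 := by norm_num
  have hpi := Real.pi_pos
  have h3 : Real.pi / 0.953 * (∑' p, majorant ((1.388 : ℝ) ^ 6)⁻¹ p) ≤ 0.42 * Real.pi := by
    calc _ ≤ Real.pi / 0.953 * 0.4 := by gcongr; exact h1.trans h2
      _ ≤ 0.42 * Real.pi := by rw [div_mul_eq_mul_div, div_le_iff₀ (by norm_num)]; nlinarith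
  have h4 := mul_le_mul_of_nonneg_right h3 (norm_nonneg (w - w₀))
  have h5 : ‖(1 / 2 : ℂ)‖ = 1 / 2 := by norm_num
  rw [h5]
  linarith

/-- On `arcBox` the number `e^{iπw}` is close to the negative real axis. -/
theorem norm_exp_add_le {w : ℂ} (hw : w ∈ arcBox) :
    ‖Complex.exp (Complex.I * Real.pi * w) + (0.8 : ℝ)‖ ≤ 0.52 := by
  obtain ⟨h1, h2, h3, h4⟩ := hw
  have hpi := Real.pi_pos
  have e : Complex.I * Real.pi * w = ((-(Real.pi * w.im) : ℝ) : ℂ) +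
      ((Real.pi * w.re : ℝ) : ℂ) * Complex.I := by
    conv_lhs => rw [← Complex.re_add_im w]
    push_cast
    linear_combination ((Real.pi : ℂ) * w.im) * Complex.I_mul_I
  have hre : (Complex.exp (Complex.I * Real.pi * w)).re =
      Real.exp (-(Real.pi * w.im)) * Real.cos (Real.pi * w.re) := by
    rw [e, Complex.exp_re]; simp
  have him : (Complex.exp (Complex.I * Real.pi * w)).im =
      Real.exp (-(Real.pi * w.im)) * Real.sin (Real.pi * w.re) := by
    rw [e, Complex.exp_im]; simp
  have hcos : Real.cos (Real.pi * w.re) ≤ -0.866 := by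
    have h : Real.cos (Real.pi * w.re) = -Real.cos (Real.pi * w.re - Real.pi) := by
      rw [Real.cos_sub_pi, neg_neg]
    have h' : Real.cos (Real.pi / 6) ≤ Real.cos (Real.pi * w.re - Real.pi) := by
      rw [← Real.cos_abs (Real.pi * w.re - Real.pi)]
      apply Real.cos_le_cos_of_nonneg_of_le_pi (abs_nonneg _) (by linarith)
      rw [abs_le]
      constructor <;> nlinarith
    rw [Real.cos_pi_div_six] at h'
    have : (1.732 : ℝ) ≤ √3 := Real.le_sqrt_of_sq_le (by norm_num)
    linarith
  have hr1 : Real.exp (-(Real.pi * w.im)) ≤ 1 := Real.exp_le_one_iff.2 (by nlinarith)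
  have hr0 : 0.367 ≤ Real.exp (-(Real.pi * w.im)) := by
    have h5 : Real.exp (-1) ≤ Real.exp (-(Real.pi * w.im)) :=
      Real.exp_le_exp.2 (by nlinarith [Real.pi_lt_four])
    have h6 := Real.exp_neg_one_gt_d9
    linarith
  rw [← abs_of_nonneg (norm_nonneg _), ← abs_of_nonneg (by norm_num : (0 : ℝ) ≤ 0.52), ← sq_le_sq,
    ← Complex.normSq_eq_norm_sq, Complex.normSq_apply, Complex.add_re, Complex.add_im, hre, him,
    Complex.ofReal_re, Complex.ofReal_im]
  have hsc := Real.sin_sq_add_cos_sq (Real.pi * w.re)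
  generalize Real.exp (-(Real.pi * w.im)) = r at *
  generalize Real.cos (Real.pi * w.re) = x at *
  generalize Real.sin (Real.pi * w.re) = y at *
  have : (r * x + 0.8) * (r * x + 0.8) + (r * y + 0) * (r * y + 0) = r ^ 2 + 1.6 * (r * x) + 0.64 := by
    linear_combination r ^ 2 * hsc
  rw [this]
  nlinarith [mul_nonneg (sub_nonneg.2 hr0) (sub_nonneg.2 hr1),
    mul_le_mul_of_nonneg_left hcos (by linarith : 0 ≤ r)]

/-- The Eisenstein series separates the points of `arcBox`, quantitatively: up to an error with
small Lipschitz constant it is the linear map `w ↦ -0.8 iπ w`, the factor `0.8` being close to the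
centre of the values of `-e^{iπw}` on `arcBox`. -/
theorem norm_arcEisenstein_sub_ge {j : ℕ} {w w₀ : ℂ} (hw : w ∈ arcBox) (hw₀ : w₀ ∈ arcBox) :
    0.2 * ‖w - w₀‖ ≤ ‖arcEisenstein (12 + 2 * j) w - arcEisenstein (12 + 2 * j) w₀‖ := by
  have h1 := norm_arcRemainder_sub_le (j := j) hw hw₀
  have h2 : ‖(Complex.exp (Complex.I * Real.pi * w) + Complex.I * Real.pi * (0.8 : ℝ) * w) -
      (Complex.exp (Complex.I * Real.pi * w₀) + Complex.I * Real.pi * (0.8 : ℝ) * w₀)‖ ≤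
      Real.pi * 0.52 * ‖w - w₀‖ := by
    refine convex_arcBox.norm_image_sub_le_of_norm_hasDerivWithin_le (𝕜 := ℂ)
      (f := fun w => Complex.exp (Complex.I * Real.pi * w) + Complex.I * Real.pi * (0.8 : ℝ) * w)
      (f' := fun w => Complex.I * Real.pi * (Complex.exp (Complex.I * Real.pi * w) + (0.8 : ℝ)))
      ?_ ?_ hw₀ hw
    · intro w _
      have := (((hasDerivAt_id w).const_mul (Complex.I * Real.pi)).cexp.add
        ((hasDerivAt_id w).const_mul (Complex.I * Real.pi * (0.8 : ℝ)))).hasDerivWithinAt (s := arcBox)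
      refine this.congr_deriv ?_
      simp only [id]
      ring
    · intro w hw
      rw [norm_mul, norm_mul, Complex.norm_I, one_mul, Complex.norm_real, Real.norm_eq_abs,
        abs_of_pos Real.pi_pos]
      exact mul_le_mul_of_nonneg_left (norm_exp_add_le hw) Real.pi_pos.le
  have h3 : Complex.I * Real.pi * (0.8 : ℝ) * (w - w₀) =
      ((Complex.exp (Complex.I * Real.pi * w) + Complex.I * Real.pi * (0.8 : ℝ) * w) -
      (Complex.exp (Complex.I * Real.pi * w₀) + Complex.I * Real.pi * (0.8 : ℝ) * w₀)) +
      (eisRemainder (12 + 2 * j) (arcPoint (12 + 2 * j) w)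
        - eisRemainder (12 + 2 * j) (arcPoint (12 + 2 * j) w₀)) -
      (arcEisenstein (12 + 2 * j) w - arcEisenstein (12 + 2 * j) w₀) := by
    simp only [arcEisenstein]; ring
  have h4 : ‖Complex.I * Real.pi * (0.8 : ℝ) * (w - w₀)‖ = Real.pi * 0.8 * ‖w - w₀‖ := by
    rw [norm_mul, norm_mul, norm_mul, Complex.norm_I, one_mul, Complex.norm_real, Complex.norm_real,
      Real.norm_eq_abs, abs_of_pos Real.pi_pos, Real.norm_eq_abs, abs_of_pos (by norm_num)]
  rw [h3] at h4
  have h5 := h4.symm.le.trans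
    ((norm_sub_le _ _).trans (add_le_add (norm_add_le _ _) le_rfl))
  have := Real.pi_gt_three
  nlinarith [norm_nonneg (w - w₀)]

/-! ### Localization of the high zeros -/

theorem exp_I_pi_mul_re (w : ℂ) : (Complex.exp (Complex.I * Real.pi * w)).re =
    Real.exp (-(Real.pi * w.im)) * Real.cos (Real.pi * w.re) := by
  rw [Complex.exp_re]; simp

theorem exp_I_pi_mul_im (w : ℂ) : (Complex.exp (Complex.I * Real.pi * w)).im =
    Real.exp (-(Real.pi * w.im)) * Real.sin (Real.pi * w.re) := by
  rw [Complex.exp_im]; simp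

theorem cos_five_pi_div_six : Real.cos (Real.pi * (5 / 6)) = -(√3 / 2) := by
  rw [show Real.pi * (5 / 6) = Real.pi - Real.pi / 6 by ring, Real.cos_pi_sub,
    Real.cos_pi_div_six]

/-- If `e^{iπw}` is within `1 / 2` of `-1`, then `w` is near an odd integer; for
`0 ≤ Re w ≤ 5 / 2` this integer can only be `1`. -/
theorem mem_arcBox_of_norm_le {w : ℂ} (h0 : 0 ≤ w.re) (h1 : w.re ≤ 5 / 2) (hb : 0 ≤ w.im)
    (h : ‖1 + Complex.exp (Complex.I * Real.pi * w)‖ ≤ 0.49) : w ∈ arcBox := by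
  have hpi := Real.pi_pos
  have hsq : (1 + Real.exp (-(Real.pi * w.im)) * Real.cos (Real.pi * w.re)) ^ 2 +
      (Real.exp (-(Real.pi * w.im)) * Real.sin (Real.pi * w.re)) ^ 2 ≤ 0.49 ^ 2 := by
    have h2 : ‖1 + Complex.exp (Complex.I * Real.pi * w)‖ ^ 2 ≤ 0.49 ^ 2 := by gcongr
    rw [← Complex.normSq_eq_norm_sq, Complex.normSq_apply, Complex.add_re, Complex.add_im,
      exp_I_pi_mul_re, exp_I_pi_mul_im, Complex.one_re, Complex.one_im] at h2
    linarith
  have hsc := Real.sin_sq_add_cos_sq (Real.pi * w.re)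
  have hr : 0 < Real.exp (-(Real.pi * w.im)) := Real.exp_pos _
  have hr51 : 0.51 ≤ Real.exp (-(Real.pi * w.im)) := by
    generalize Real.exp (-(Real.pi * w.im)) = r at *
    generalize Real.sin (Real.pi * w.re) = s at *
    generalize Real.cos (Real.pi * w.re) = c at *
    have hc : -1 ≤ c := by nlinarith
    have : (1 - r) ^ 2 ≤ 0.49 ^ 2 := by nlinarith
    have := abs_le_of_sq_le_sq' this (by norm_num)
    linarith [this.2]
  have hcos : Real.cos (Real.pi * w.re) < -(√3 / 2) := by
    have h3 : √3 ^ 2 = 3 := Real.sq_sqrt (by norm_num)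
    have h30 : 0 ≤ √3 := Real.sqrt_nonneg _
    generalize Real.exp (-(Real.pi * w.im)) = r at *
    generalize Real.sin (Real.pi * w.re) = s at *
    generalize Real.cos (Real.pi * w.re) = c at *
    have hc : c < 0 := by
      by_contra! hc
      nlinarith [mul_nonneg hr.le hc, sq_nonneg (r * s)]
    -- the distance from `-1` to the ray through `e^{iφ}` is `|sin φ|`
    have hs : s ^ 2 ≤ 0.49 ^ 2 := by
      have : (1 + r * c) ^ 2 + (r * s) ^ 2 = s ^ 2 + (r + c) ^ 2 := by
        linear_combination (r ^ 2 - 1) * hsc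
      nlinarith [sq_nonneg (r + c)]
    by_contra! hcc
    nlinarith
  have him : w.im ≤ 1 / 4 := by
    by_contra! him
    have h4 : Real.exp (-(Real.pi * w.im)) ≤ Real.exp (-(Real.pi / 4)) :=
      Real.exp_le_exp.2 (by nlinarith)
    have h5 := Real.quadratic_le_exp_of_nonneg (x := Real.pi / 4) (by positivity)
    have h6 : Real.exp (-(Real.pi / 4)) * Real.exp (Real.pi / 4) = 1 := by
      rw [← Real.exp_add]; simp
    have h7 := Real.pi_gt_three
    have h8 : 2 ≤ Real.exp (Real.pi / 4) := by nlinarith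
    nlinarith [Real.exp_pos (-(Real.pi / 4))]
  refine ⟨?_, ?_, hb, him⟩
  · by_contra! hlt
    have := Real.cos_le_cos_of_nonneg_of_le_pi (by positivity) (by linarith)
      (mul_le_mul_of_nonneg_left hlt.le hpi.le)
    rw [cos_five_pi_div_six] at this
    linarith
  · by_contra! hlt
    have h2 : Real.cos (Real.pi * w.re) = Real.cos |Real.pi * (2 - w.re)| := by
      rw [Real.cos_abs, show Real.pi * (2 - w.re) = 2 * Real.pi - Real.pi * w.re by ring,
        Real.cos_two_pi_sub]
    have h3 : |Real.pi * (2 - w.re)| ≤ Real.pi * (5 / 6) := by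
      rw [abs_mul, abs_of_pos hpi]
      exact mul_le_mul_of_nonneg_left (abs_le.2 ⟨by linarith, by linarith⟩) hpi.le
    have := Real.cos_le_cos_of_nonneg_of_le_pi (abs_nonneg _) (by linarith) h3
    rw [cos_five_pi_div_six, ← h2] at this
    linarith

/-- A point outside the open unit disc, at height at least `cos (7π/6k)` whose argument is far from
`π / 2` has modulus noticeably larger than `1`. The numerator `42.4` is just below `4.3 π²`. -/
theorem normSq_ge_of_arg_large {k : ℕ} (hk : 12 ≤ k) {w : ℂ} (ha : 5 / 2 ≤ w.re)
    (ha2 : Real.pi * w.re / k ≤ Real.pi / 2)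
    (hy : Real.cos (Real.pi * (7 / 6) / k) ≤ (arcPoint k w).im) :
    1 + 42.4 / (k : ℝ) ^ 2 ≤ Complex.normSq (arcPoint k w) := by
  have hk' : (12 : ℝ) ≤ k := by exact_mod_cast hk
  have hk0 : (0 : ℝ) < k := by linarith
  have hpi := Real.pi_pos
  rw [arcPoint_im] at hy
  rw [arcPoint_normSq]
  set v := Real.pi * (5 / 2) / k with hv
  set u := Real.pi * (7 / 6) / k with hu
  have hv0 : 0 < v := by positivity
  have hva : v ≤ Real.pi * w.re / k := by rw [hv]; gcongr
  have hcos1 : Real.cos (Real.pi * w.re / k) ≤ Real.cos v :=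
    Real.cos_le_cos_of_nonneg_of_le_pi hv0.le (by linarith) hva
  have hcos2 : Real.cos v < 1 / √(v ^ 2 + 1) :=
    Real.cos_lt_one_div_sqrt_sq_add_one (by linarith) (by linarith) hv0.ne'
  have hcos0 : 0 ≤ Real.cos (Real.pi * w.re / k) :=
    Real.cos_nonneg_of_neg_pi_div_two_le_of_le (by linarith) ha2
  have hu1 : u ≤ 0.2618 * (7 / 6) := pi_mul_div_le hk (by norm_num)
  have hu0 : 0 ≤ u := by positivity
  have hcu : 1 - u ^ 2 / 2 ≤ Real.cos u := Real.one_sub_sq_div_two_le_cos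
  have hc2 : Real.cos (Real.pi * w.re / k) ^ 2 * (v ^ 2 + 1) ≤ 1 := by
    have h1 : Real.cos (Real.pi * w.re / k) ^ 2 ≤ (1 / √(v ^ 2 + 1)) ^ 2 := by
      gcongr
      exact hcos1.trans hcos2.le
    rw [div_pow, one_pow, Real.sq_sqrt (by positivity), le_div_iff₀ (by positivity)] at h1
    exact h1
  have hlow : (1 - u ^ 2 / 2) ^ 2 ≤
      Real.exp (Real.pi * w.im / k) ^ 2 * Real.cos (Real.pi * w.re / k) ^ 2 := by
    rw [← mul_pow]
    have : 0 ≤ 1 - u ^ 2 / 2 := by nlinarith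
    gcongr
    exact hcu.trans hy
  set p := Real.pi ^ 2 / (k : ℝ) ^ 2 with hp
  have hup : u ^ 2 = 49 / 36 * p := by rw [hu, hp]; ring
  have hvp : v ^ 2 = 25 / 4 * p := by rw [hv, hp]; ring
  have hp0 : 0 ≤ p := by positivity
  have hp1 : p ≤ 0.0687 := by
    rw [hp, div_le_iff₀ (by positivity)]
    nlinarith [Real.pi_lt_d4]
  have hpk : 42.4 / (k : ℝ) ^ 2 ≤ 4.3 * p := by
    rw [hp, ← mul_div_assoc]
    gcongr
    nlinarith [Real.pi_gt_d4]
  have hfin : (1 - u ^ 2 / 2) ^ 2 * (v ^ 2 + 1) ≤ Real.exp (Real.pi * w.im / k) ^ 2 := by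
    calc _ ≤ Real.exp (Real.pi * w.im / k) ^ 2 * Real.cos (Real.pi * w.re / k) ^ 2 * (v ^ 2 + 1) := by
          gcongr
      _ ≤ Real.exp (Real.pi * w.im / k) ^ 2 * 1 := by rw [mul_assoc]; gcongr
      _ = _ := mul_one _
  have : 1 + 4.3 * p ≤ (1 - u ^ 2 / 2) ^ 2 * (v ^ 2 + 1) := by
    rw [hup, hvp]
    have h1 : 1 - 49 / 36 * p ≤ (1 - 49 / 36 * p / 2) ^ 2 := by nlinarith
    have h2 : (1 - 49 / 36 * p) * (25 / 4 * p + 1) ≤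
        (1 - 49 / 36 * p / 2) ^ 2 * (25 / 4 * p + 1) := by gcongr
    nlinarith
  linarith

/-- Zeros high up in the right half of the fundamental domain have their coordinate in
`arcBox`. -/
theorem exists_mem_arcBox_of_zero {j : ℕ} (hk4 : (12 + 2 * j) % 4 = 0) {z : ℂ}
    (hz : 1 ≤ Complex.normSq z) (hx : 0 ≤ z.re) (hx' : z.re ≤ 1 / 2)
    (hy : Real.cos (Real.pi * (7 / 6) / (12 + 2 * j : ℕ)) ≤ z.im)
    (h : 1 + (z ^ (12 + 2 * j))⁻¹ + eisRemainder (12 + 2 * j) z = 0) :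
    ∃ w ∈ arcBox, arcPoint (12 + 2 * j) w = z := by
  set k := 12 + 2 * j with hk
  have hk12 : 12 ≤ k := by omega
  have hk' : (12 : ℝ) ≤ k := by exact_mod_cast hk12
  have hkj : (k : ℝ) = 12 + 2 * j := by rw [hk]; push_cast; ring
  have hy2 : 0.953 ≤ z.im := by
    have h1 : Real.pi * (7 / 6) / k ≤ 0.2618 * (7 / 6) := pi_mul_div_le hk12 (by norm_num)
    have h2 : 0 ≤ Real.pi * (7 / 6) / k := by have := Real.pi_pos; positivity
    have h3 := Real.one_sub_sq_div_two_le_cos (x := Real.pi * (7 / 6) / k)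
    nlinarith
  have hB : 1.155 ≤ Complex.normSq (z - 1) := by
    rw [Complex.normSq_apply]
    simp only [Complex.sub_re, Complex.sub_im, Complex.one_re, Complex.one_im]
    nlinarith
  have hR := norm_eisRemainder_le (j := j) (C := 1.155) hz hx hx' (by norm_num) (by norm_num)
    le_rfl hB
  rw [← hk] at hR
  -- `1.155 ≤ |z - 1|²` serves both as the bound for the largest term and as the decay rate
  have hnum : ((1.155 : ℝ) ^ 6)⁻¹ + 0.058 ≤ 0.48 := by norm_num
  have hCj : 1 + 0.155 * (j : ℝ) ≤ 1.155 ^ j := by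
    have := one_add_mul_le_pow (a := (0.155 : ℝ)) (by norm_num) j
    norm_num at this ⊢
    linarith
  have hj0 : (0 : ℝ) ≤ j := Nat.cast_nonneg j
  have hCpos : (0 : ℝ) < 1.155 ^ j := by positivity
  have hR2 : ‖eisRemainder k z‖ * (1 + 0.155 * j) ≤ 0.48 := by
    calc _ ≤ ((1.155 ^ j)⁻¹ * (((1.155 : ℝ) ^ 6)⁻¹ + 0.058)) * 1.155 ^ j := by gcongr
      _ = ((1.155 : ℝ) ^ 6)⁻¹ + 0.058 := by field_simp
      _ ≤ _ := hnum
  obtain ⟨w, rfl, hw0, hw1, hw2⟩ := exists_arcPoint_eq (k := k) (by omega) hz hx (by linarith)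
  have hsmall : ‖1 + ((arcPoint k w) ^ k)⁻¹‖ = ‖eisRemainder k (arcPoint k w)‖ := by
    rw [← norm_neg (eisRemainder _ _)]
    congr 1
    linear_combination h
  refine ⟨w, mem_arcBox_of_norm_le hw0 ?_ hw2 ?_, rfl⟩
  · by_contra! ha
    have hN := normSq_ge_of_arg_large hk12 ha.le hw1 hy
    -- `1 - |z|^{-k}` decays only like `1 / k`, while the remainder decays geometrically
    have hr : ‖((arcPoint k w) ^ k)⁻¹‖ = (Complex.normSq (arcPoint k w) ^ (6 + j))⁻¹ := by
      rw [norm_inv, norm_pow, Complex.normSq_eq_norm_sq, ← pow_mul]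
      congr 2
      omega
    have hpow : 1 + 21.2 / (k : ℝ) ≤ Complex.normSq (arcPoint k w) ^ (6 + j) := by
      have h1 := one_add_mul_le_pow (a := 42.4 / (k : ℝ) ^ 2)
        (by have : 0 ≤ 42.4 / (k : ℝ) ^ 2 := by positivity
            linarith) (6 + j)
      have h2 : ((6 + j : ℕ) : ℝ) * (42.4 / (k : ℝ) ^ 2) = 21.2 / k := by
        have : ((6 + j : ℕ) : ℝ) = k / 2 := by rw [hkj]; push_cast; ring
        rw [this]; field_simp; norm_num
      rw [h2] at h1
      exact h1.trans (by gcongr)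
    have h3 : (Complex.normSq (arcPoint k w) ^ (6 + j))⁻¹ ≤ (1 + 21.2 / (k : ℝ))⁻¹ := by
      gcongr
    have h4 : (1 + 21.2 / (k : ℝ))⁻¹ = 1 - 21.2 / (k + 21.2) := by
      field_simp
      ring
    have h5 : 1 - ‖((arcPoint k w) ^ k)⁻¹‖ ≤ ‖1 + ((arcPoint k w) ^ k)⁻¹‖ := by
      have := norm_sub_norm_le (1 : ℂ) (-((arcPoint k w) ^ k)⁻¹)
      rwa [norm_one, norm_neg, sub_neg_eq_add] at this
    have h6 : 21.2 / (k + 21.2) ≤ ‖eisRemainder k (arcPoint k w)‖ := by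
      rw [hsmall, hr] at h5
      linarith
    have h7 : 21.2 / (k + 21.2) * (1 + 0.155 * (j : ℝ)) ≤ 0.48 :=
      (mul_le_mul_of_nonneg_right h6 (by positivity)).trans hR2
    rw [div_mul_eq_mul_div, div_le_iff₀ (by positivity), hkj] at h7
    linarith
  · rw [← arcPoint_inv_pow (by omega) hk4, hsmall]
    nlinarith [norm_nonneg (eisRemainder k (arcPoint k w)),
      mul_nonneg (norm_nonneg (eisRemainder k (arcPoint k w))) hj0]

/-! ### The nome, symmetries, and a zero on the arc -/

theorem norm_nome (z : UpperHalfPlane) : ‖nome z‖ = Real.exp (-(2 * Real.pi * z.im)) := by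
  rw [nome, Complex.norm_exp]
  congr 1
  simp [Complex.mul_re]

theorem norm_nome_lt_one (z : UpperHalfPlane) : ‖nome z‖ < 1 := by
  rw [norm_nome, Real.exp_lt_one_iff]
  have := z.im_pos
  have := Real.pi_pos
  have : 0 < 2 * Real.pi * z.im := by positivity
  linarith

theorem norm_nome_le_iff {z w : UpperHalfPlane} : ‖nome z‖ ≤ ‖nome w‖ ↔ w.im ≤ z.im := by
  rw [norm_nome, norm_nome, Real.exp_le_exp, neg_le_neg_iff,
    mul_le_mul_iff_right₀ (by have := Real.pi_pos; positivity)]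

theorem nome_ne_zero (z : UpperHalfPlane) : nome z ≠ 0 := Complex.exp_ne_zero _

theorem nome_eq_qParam (z : UpperHalfPlane) : nome z = Function.Periodic.qParam 1 z := by
  simp [nome, Function.Periodic.qParam]

/-- The negConjion `z ↦ -z̄` of the upper half plane. -/
noncomputable def negConj (z : UpperHalfPlane) : UpperHalfPlane :=
  ⟨-(starRingEnd ℂ (z : ℂ)), by simpa using z.im_pos⟩

theorem im_negConj (z : UpperHalfPlane) : (negConj z).im = z.im := by
  change (-(starRingEnd ℂ (z : ℂ))).im = z.im
  simp

theorem re_negConj (z : UpperHalfPlane) : (negConj z).re = -z.re := by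
  change (-(starRingEnd ℂ (z : ℂ))).re = -z.re
  simp

theorem nome_negConj (z : UpperHalfPlane) : nome (negConj z) = starRingEnd ℂ (nome z) := by
  rw [nome, nome, ← Complex.exp_conj]
  congr 1
  simp [negConj, Complex.conj_ofNat]

theorem exists_nome_eq {q : ℂ} (hq0 : q ≠ 0) (hq : ‖q‖ < 1) : ∃ z : UpperHalfPlane, nome z = q := by
  refine ⟨⟨Function.Periodic.invQParam 1 q,
    Function.Periodic.im_invQParam_pos_of_norm_lt_one one_pos hq hq0⟩, ?_⟩
  rw [nome_eq_qParam]
  exact Function.Periodic.qParam_right_inv one_ne_zero hq0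

/-- The function on the unit disc whose value at `q_z` is `E_k(z)`. -/
noncomputable def eisensteinDisc {k : ℕ} (hk : 3 ≤ k) : ℂ → ℂ :=
  UpperHalfPlane.cuspFunction 1 (ModularForm.E hk)

section

variable {k : ℕ} (hk : 3 ≤ k)

theorem eisensteinDisc_nome (z : UpperHalfPlane) :
    eisensteinDisc hk (nome z) = ModularForm.E hk z := by
  rw [nome_eq_qParam]
  exact SlashInvariantFormClass.eq_cuspFunction (ModularForm.E hk) z one_mem_strictPeriods_SL
    one_ne_zero

theorem differentiableOn_eisensteinDisc :
    DifferentiableOn ℂ (eisensteinDisc hk) (Metric.ball 0 1) := fun q hq =>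
  (ModularFormClass.differentiableAt_cuspFunction (ModularForm.E hk) one_pos
    one_mem_strictPeriods_SL (by simpa using hq)).differentiableWithinAt

theorem hasSum_eisensteinDisc {q : ℂ} (hq : ‖q‖ < 1) :
    HasSum (fun n => (eisensteinQ hk).coeff n * q ^ n) (eisensteinDisc hk q) :=
  UpperHalfPlane.hasSum_qExpansion_of_norm_lt one_pos
    (SlashInvariantFormClass.periodic_comp_ofComplex (ModularForm.E hk) one_mem_strictPeriods_SL)
    (ModularFormClass.holo (ModularForm.E hk)) (ModularFormClass.bdd_at_infty (ModularForm.E hk)) hq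

theorem eisensteinDisc_zero (hk2 : Even k) : eisensteinDisc hk 0 = 1 := by
  have h := hasSum_single (f := fun n => (eisensteinQ hk).coeff n * (0 : ℂ) ^ n) 0
    fun n hn => by simp [hn]
  have h2 := (hasSum_eisensteinDisc hk (q := 0) (by simp)).unique h
  rw [h2, eisensteinQ_coeff hk hk2]
  simp

theorem conj_eisensteinQ_coeff (hk2 : Even k) (n : ℕ) :
    starRingEnd ℂ ((eisensteinQ hk).coeff n) = (eisensteinQ hk).coeff n := by
  rw [eisensteinQ_coeff hk hk2]
  split_ifs <;> simp [Complex.conj_ofNat]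

theorem eisensteinDisc_conj (hk2 : Even k) {q : ℂ} (hq : ‖q‖ < 1) :
    eisensteinDisc hk (starRingEnd ℂ q) = starRingEnd ℂ (eisensteinDisc hk q) := by
  have h1 := hasSum_eisensteinDisc hk (q := starRingEnd ℂ q) (by simpa using hq)
  have h2 := (hasSum_eisensteinDisc hk hq).map (starRingEnd ℂ) Complex.continuous_conj
  refine h1.unique ?_
  convert! h2 using 2 with n
  simp [conj_eisensteinQ_coeff hk hk2]

theorem seriesValue_theta_conj (hk2 : Even k) (q : ℂ) :
    seriesValue (ramanujanTheta (eisensteinQ hk)) (starRingEnd ℂ q) =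
      starRingEnd ℂ (seriesValue (ramanujanTheta (eisensteinQ hk)) q) := by
  rw [seriesValue, seriesValue, Complex.conj_tsum]
  refine tsum_congr fun n => ?_
  simp [ramanujanTheta, conj_eisensteinQ_coeff hk hk2]

theorem E_negConj (hk2 : Even k) (z : UpperHalfPlane) :
    ModularForm.E hk (negConj z) = starRingEnd ℂ (ModularForm.E hk z) := by
  rw [← eisensteinDisc_nome, nome_negConj, eisensteinDisc_conj hk hk2 (norm_nome_lt_one z),
    eisensteinDisc_nome]

/-- The transformation law under `z ↦ -1 / z`. -/
theorem E_neg_inv (z : UpperHalfPlane) :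
    ModularForm.E hk ⟨(-(z : ℂ))⁻¹, z.im_inv_neg_coe_pos⟩ = (z : ℂ) ^ k * ModularForm.E hk z := by
  have h : SlashAction.map (k : ℤ) ModularGroup.S (ModularForm.E hk : UpperHalfPlane → ℂ) =
      ModularForm.E hk :=
    SlashInvariantFormClass.slash_action_eq (ModularForm.E hk) _ ⟨ModularGroup.S, rfl⟩
  have h2 := congrFun h z
  rw [SlashInvariantForm.slash_S_apply] at h2
  rw [← h2, zpow_neg, zpow_natCast]
  have := z.ne_zero
  field_simp

end

/-- The Eisenstein series in the coordinate of `arcBox`. -/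
theorem E_eq_arcEisenstein {j : ℕ} (hk4 : (12 + 2 * j) % 4 = 0) (hk : 3 ≤ 12 + 2 * j) {w : ℂ}
    (hw : w ∈ arcBox) {z : UpperHalfPlane} (hz : (z : ℂ) = arcPoint (12 + 2 * j) w) :
    ModularForm.E hk z = arcEisenstein (12 + 2 * j) w := by
  obtain ⟨h1, h2, h3, h4, h5⟩ := arcPoint_bounds (k := 12 + 2 * j) (by omega) hw
  rw [E_eq_one_add_inv_pow_add_eisRemainder hk ⟨6 + j, by ring⟩ z (by
    rw [hz]; exact summable_mixedTerm h1 h2 (by linarith) (by linarith)), hz,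
    arcPoint_inv_pow (by omega) hk4, arcEisenstein]

theorem arcPoint_im_pos {k : ℕ} (hk : 12 ≤ k) {w : ℂ} (hw : w ∈ arcBox) : 0 < (arcPoint k w).im := by
  obtain ⟨h1, -, -, h4, -⟩ := arcPoint_bounds hk hw
  have : 0 < ‖arcPoint k w‖ := by
    rw [norm_pos_iff]
    intro h
    simp [h] at h1
    linarith
  linarith

theorem ofReal_mem_arcBox {a : ℝ} (h : a ∈ Set.Icc (5 / 6 : ℝ) (7 / 6)) : (a : ℂ) ∈ arcBox := by
  simp only [arcBox, Set.mem_ofPred_eq, Complex.ofReal_re, Complex.ofReal_im]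
  exact ⟨h.1, h.2, le_rfl, by norm_num⟩

/-- On the unit circle, `e^{-iπa/2} E_k` is real: this combines `E_k(-z̄) = conj E_k(z)` with
the weight `k` transformation under `z ↦ -1/z`. -/
theorem arcEisenstein_mul_im {j : ℕ} (hk4 : (12 + 2 * j) % 4 = 0) {a : ℝ}
    (ha : a ∈ Set.Icc (5 / 6 : ℝ) (7 / 6)) :
    (Complex.exp (-(Complex.I * Real.pi * a / 2)) * arcEisenstein (12 + 2 * j) a).im = 0 := by
  have hk : 3 ≤ 12 + 2 * j := by omega
  have hbox := ofReal_mem_arcBox ha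
  set z : UpperHalfPlane := ⟨arcPoint (12 + 2 * j) a, arcPoint_im_pos (by omega) hbox⟩ with hz
  have hE := E_eq_arcEisenstein hk4 hk hbox (z := z) rfl
  have hns : Complex.normSq (z : ℂ) = 1 := by
    have := arcPoint_normSq (12 + 2 * j) a
    simpa using this
  have hrefl : negConj z = ⟨(-(z : ℂ))⁻¹, z.im_inv_neg_coe_pos⟩ := by
    ext
    have hne := z.ne_zero
    have h1 : (z : ℂ) * starRingEnd ℂ (z : ℂ) = 1 := by rw [Complex.mul_conj, hns]; simp
    change -(starRingEnd ℂ (z : ℂ)) = (-(z : ℂ))⁻¹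
    rw [inv_neg, neg_inj]
    exact eq_inv_of_mul_eq_one_right h1
  have h1 := E_negConj hk ⟨6 + j, by ring⟩ z
  rw [hrefl, E_neg_inv, hE] at h1
  have hpow : (z : ℂ) ^ (12 + 2 * j) = Complex.exp (-(Complex.I * Real.pi * a)) := by
    rw [← inv_inv ((z : ℂ) ^ (12 + 2 * j)), Complex.exp_neg]
    congr 1
    exact arcPoint_inv_pow (by omega) hk4 _
  rw [hpow] at h1
  rw [← Complex.conj_eq_iff_im, map_mul, ← h1, ← Complex.exp_conj]
  have : (starRingEnd ℂ) (-(Complex.I * Real.pi * a / 2)) = Complex.I * Real.pi * a / 2 := by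
    simp [Complex.conj_ofNat, neg_div]
  rw [this, ← mul_assoc, ← Complex.exp_add]
  congr 2
  ring

theorem arcEisenstein_mul_re (k : ℕ) (a : ℝ) :
    (Complex.exp (-(Complex.I * Real.pi * a / 2)) * arcEisenstein k a).re =
      2 * Real.cos (Real.pi * a / 2) +
      (Complex.exp (-(Complex.I * Real.pi * a / 2)) * eisRemainder k (arcPoint k a)).re := by
  have h : Complex.exp (-(Complex.I * Real.pi * a / 2)) * arcEisenstein k a =
      ((2 * Real.cos (Real.pi * a / 2) : ℝ) : ℂ) +
      Complex.exp (-(Complex.I * Real.pi * a / 2)) * eisRemainder k (arcPoint k a) := by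
    rw [arcEisenstein, mul_add, mul_add, mul_one, ← Complex.exp_add]
    push_cast
    rw [Complex.two_cos, add_comm (Complex.exp (Real.pi * a / 2 * Complex.I))]
    congr 3 <;> ring_nf
  rw [h, Complex.add_re, Complex.ofReal_re]

/-- Sign change of the real function `e^{-iπa/2} E_k` on the arc. -/
theorem exists_arc_zero {j : ℕ} (hk4 : (12 + 2 * j) % 4 = 0) :
    ∃ a ∈ Set.Icc (5 / 6 : ℝ) (7 / 6), arcEisenstein (12 + 2 * j) a = 0 := by
  set f : ℝ → ℝ := fun a =>
    (Complex.exp (-(Complex.I * Real.pi * a / 2)) * arcEisenstein (12 + 2 * j) a).re with hf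
  have hcont : ContinuousOn f (Set.Icc (5 / 6 : ℝ) (7 / 6)) := by
    have h1 : ContinuousOn (fun w => eisRemainder (12 + 2 * j) (arcPoint (12 + 2 * j) w)) arcBox := by
      refine LipschitzOnWith.continuousOn (K := Real.toNNReal (0.21 * Real.pi)) ?_
      refine LipschitzOnWith.of_dist_le_mul fun w hw w₀ hw₀ => ?_
      rw [Real.coe_toNNReal _ (by have := Real.pi_pos; positivity), dist_eq_norm, dist_eq_norm]
      exact norm_arcRemainder_sub_le hw hw₀
    have h2 : ContinuousOn (fun a : ℝ => eisRemainder (12 + 2 * j) (arcPoint (12 + 2 * j) a))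
        (Set.Icc (5 / 6 : ℝ) (7 / 6)) :=
      h1.comp Complex.continuous_ofReal.continuousOn fun a ha => ofReal_mem_arcBox ha
    have h3 : ContinuousOn (fun a : ℝ => arcEisenstein (12 + 2 * j) a)
        (Set.Icc (5 / 6 : ℝ) (7 / 6)) := by
      unfold arcEisenstein
      exact (by fun_prop : Continuous fun a : ℝ =>
        1 + Complex.exp (Complex.I * Real.pi * a)).continuousOn.add h2
    exact Complex.continuous_re.comp_continuousOn
      ((by fun_prop : Continuous fun a : ℝ =>
        Complex.exp (-(Complex.I * Real.pi * a / 2))).continuousOn.mul h3)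
  have hrem : ∀ a ∈ Set.Icc (5 / 6 : ℝ) (7 / 6),
      |(Complex.exp (-(Complex.I * Real.pi * a / 2)) *
        eisRemainder (12 + 2 * j) (arcPoint (12 + 2 * j) a)).re| ≤ 0.2 := by
    intro a ha
    refine (Complex.abs_re_le_norm _).trans ?_
    have : ‖Complex.exp (-(Complex.I * Real.pi * a / 2))‖ = 1 := by
      rw [Complex.norm_exp]; simp
    rw [norm_mul, this, one_mul]
    exact norm_arcRemainder_le (ofReal_mem_arcBox ha)
  have hcos : 1 / 4 ≤ Real.cos (Real.pi * (5 / 6) / 2) := by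
    have h1 := Real.cos_sq (Real.pi * (5 / 6) / 2)
    rw [show 2 * (Real.pi * (5 / 6) / 2) = Real.pi * (5 / 6) by ring, cos_five_pi_div_six] at h1
    have h2 : 0 ≤ Real.cos (Real.pi * (5 / 6) / 2) := by
      have := Real.pi_pos
      exact Real.cos_nonneg_of_neg_pi_div_two_le_of_le (by linarith) (by linarith)
    have h3 : √3 ≤ 1.75 := Real.sqrt_le_iff.2 ⟨by norm_num, by norm_num⟩
    nlinarith
  have h56 : (5 / 6 : ℝ) ∈ Set.Icc (5 / 6 : ℝ) (7 / 6) := ⟨le_rfl, by norm_num⟩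
  have h76 : (7 / 6 : ℝ) ∈ Set.Icc (5 / 6 : ℝ) (7 / 6) := ⟨by norm_num, le_rfl⟩
  have hl : 0 ≤ f (5 / 6) := by
    have h1 := arcEisenstein_mul_re (12 + 2 * j) (5 / 6)
    have h2 := (abs_le.1 (hrem _ h56)).1
    simp only [hf]
    linarith
  have hr : f (7 / 6) ≤ 0 := by
    have h1 := arcEisenstein_mul_re (12 + 2 * j) (7 / 6)
    have h2 := (abs_le.1 (hrem _ h76)).2
    have h3 : Real.cos (Real.pi * (7 / 6) / 2) = -Real.cos (Real.pi * (5 / 6) / 2) := by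
      rw [← Real.cos_pi_sub]; congr 1; ring
    simp only [hf]
    linarith
  obtain ⟨a, ha, hfa⟩ := intermediate_value_Icc' (by norm_num : (5 / 6 : ℝ) ≤ 7 / 6) hcont ⟨hr, hl⟩
  refine ⟨a, ha, ?_⟩
  have h0 : Complex.exp (-(Complex.I * Real.pi * a / 2)) * arcEisenstein (12 + 2 * j) a = 0 :=
    Complex.ext hfa (arcEisenstein_mul_im hk4 ha)
  exact (mul_eq_zero.1 h0).resolve_left (Complex.exp_ne_zero _)

/-! ### The dominant zero and the asymptotics -/

/-- A zero `z₀` of `E_k` on the unit circle together with the facts that characterise it: among the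
zeros in the closed fundamental domain it and its mirror image are the highest ones. -/
theorem exists_dominant_zero {j : ℕ} (hk4 : (12 + 2 * j) % 4 = 0) (hk : 3 ≤ 12 + 2 * j) :
    ∃ (z₀ : UpperHalfPlane) (a : ℝ), a ∈ Set.Icc (5 / 6 : ℝ) (7 / 6) ∧
      (z₀ : ℂ) = arcPoint (12 + 2 * j) a ∧
      ModularForm.E hk z₀ = 0 ∧ Complex.normSq (z₀ : ℂ) = 1 ∧ 0 < z₀.re ∧ z₀.re < 1 / 2 ∧
      0.953 ≤ z₀.im ∧
      ∀ z : UpperHalfPlane, |z.re| ≤ 1 / 2 → 1 ≤ Complex.normSq (z : ℂ) → z₀.im ≤ z.im →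
        ModularForm.E hk z = 0 → z = z₀ ∨ z = negConj z₀ := by
  have heven : Even (12 + 2 * j) := ⟨6 + j, by ring⟩
  obtain ⟨a, ha, hza⟩ := exists_arc_zero hk4
  have hbox := ofReal_mem_arcBox ha
  obtain ⟨h1, h2, h3, h4, h5⟩ := arcPoint_bounds (k := 12 + 2 * j) (by omega) hbox
  set z₀ : UpperHalfPlane := ⟨arcPoint (12 + 2 * j) a, arcPoint_im_pos (by omega) hbox⟩ with hz₀
  have hE₀ : ModularForm.E hk z₀ = 0 := by rw [E_eq_arcEisenstein hk4 hk hbox rfl, hza]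
  have hns : Complex.normSq (z₀ : ℂ) = 1 := by simpa using arcPoint_normSq (12 + 2 * j) a
  have hnorm : ‖arcPoint (12 + 2 * j) a‖ = 1 := by
    have : ‖arcPoint (12 + 2 * j) a‖ ^ 2 = 1 := by rw [← Complex.normSq_eq_norm_sq]; exact hns
    exact (pow_eq_one_iff_of_nonneg (norm_nonneg _) two_ne_zero).1 this
  have hk0 : (0 : ℝ) < (12 + 2 * j : ℕ) := by positivity
  have hθ : Real.pi * a / (12 + 2 * j : ℕ) ≤ 0.2618 * a :=
    pi_mul_div_le (by omega) (by linarith [ha.1])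
  have hθ0 : 0 < Real.pi * a / (12 + 2 * j : ℕ) := by
    have := Real.pi_pos
    have : 0 < a := by linarith [ha.1]
    positivity
  have hpi3 := Real.pi_gt_three
  have him : z₀.im = Real.cos (Real.pi * a / (12 + 2 * j : ℕ)) := by
    have := arcPoint_im (12 + 2 * j) a
    simpa using! this
  have hcos : Real.cos (Real.pi * (7 / 6) / (12 + 2 * j : ℕ)) ≤ z₀.im := by
    rw [him]
    have h6 : Real.pi * (7 / 6) / (12 + 2 * j : ℕ) ≤ 0.2618 * (7 / 6) :=
      pi_mul_div_le (by omega) (by norm_num)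
    refine Real.cos_le_cos_of_nonneg_of_le_pi hθ0.le (by linarith) ?_
    have := ha.2
    gcongr
  have hright : ∀ z : UpperHalfPlane, 0 ≤ z.re → z.re ≤ 1 / 2 → 1 ≤ Complex.normSq (z : ℂ) →
      z₀.im ≤ z.im → ModularForm.E hk z = 0 → z = z₀ := by
    intro z hx hx' hz hy hE
    have hy2 : (0.953 : ℝ) ≤ (z : ℂ).im := by
      have : 0.953 * ‖arcPoint (12 + 2 * j) a‖ ≤ z₀.im := h4
      rw [hnorm] at this
      have h7 : z.im = (z : ℂ).im := rfl
      linarith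
    have hx'' : (z : ℂ).re ≤ 1 / 2 := hx'
    have hB : 1 ≤ Complex.normSq ((z : ℂ) - 1) := by
      rw [Complex.normSq_apply]
      simp only [Complex.sub_re, Complex.sub_im, Complex.one_re, Complex.one_im]
      nlinarith
    rw [E_eq_one_add_inv_pow_add_eisRemainder hk heven z (summable_mixedTerm hz hx hx' hB)] at hE
    obtain ⟨w, hw, hwz⟩ := exists_mem_arcBox_of_zero hk4 hz hx hx' (hcos.trans hy) hE
    have hwE : arcEisenstein (12 + 2 * j) w = 0 := by
      rw [arcEisenstein, ← arcPoint_inv_pow (by omega) hk4, hwz]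
      exact hE
    have h8 := norm_arcEisenstein_sub_ge (j := j) hw hbox
    rw [hwE, hza, sub_self, norm_zero] at h8
    have h9 : w = a := by
      rw [← sub_eq_zero, ← norm_le_zero_iff]
      linarith
    ext
    rw [← hwz, h9]
  refine ⟨z₀, a, ha, rfl, hE₀, hns, ?_, ?_, ?_, fun z hx hz hy hE => ?_⟩
  · have : z₀.re = Real.sin (Real.pi * a / (12 + 2 * j : ℕ)) := by
      have := arcPoint_re (12 + 2 * j) a
      simpa using! this
    rw [this]
    exact Real.sin_pos_of_pos_of_lt_pi hθ0 (by linarith [ha.2])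
  · have : z₀.re ≤ 0.45 := h3
    linarith
  · have : 0.953 * ‖arcPoint (12 + 2 * j) a‖ ≤ z₀.im := h4
    rw [hnorm] at this
    linarith
  · rw [abs_le] at hx
    rcases le_or_gt 0 z.re with h | h
    · exact Or.inl (hright z h hx.2 hz hy hE)
    · right
      have hre := re_negConj z
      have h6 := hright (negConj z) (by rw [hre]; linarith) (by rw [hre]; linarith)
        (by simpa [negConj] using hz) (by rw [im_negConj]; exact hy)
        (by rw [E_negConj hk heven, hE, map_zero])
      rw [← h6]
      ext
      simp [negConj]

theorem nome_int_vadd (z : UpperHalfPlane) (n : ℤ) : nome ((n : ℝ) +ᵥ z) = nome z := by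
  rw [nome, nome, UpperHalfPlane.coe_vadd, mul_add]
  rw [Complex.exp_add]
  have : Complex.exp (2 * Real.pi * Complex.I * ((n : ℝ) : ℂ)) = 1 := by
    rw [Complex.exp_eq_one_iff]
    exact ⟨n, by push_cast; ring⟩
  rw [this, one_mul]

/-- A zero of `E_k` in the upper half plane that is at least as high as `z₀` is a translate of
`z₀` or of its mirror image. -/
theorem nome_eq_of_zero {k : ℕ} (hk : 3 ≤ k) {z₀ : UpperHalfPlane}
    (hns : Complex.normSq (z₀ : ℂ) = 1) (him : 0.953 ≤ z₀.im)
    (huniq : ∀ z : UpperHalfPlane, |z.re| ≤ 1 / 2 → 1 ≤ Complex.normSq (z : ℂ) → z₀.im ≤ z.im →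
        ModularForm.E hk z = 0 → z = z₀ ∨ z = negConj z₀)
    {z : UpperHalfPlane} (hy : z₀.im ≤ z.im) (hE : ModularForm.E hk z = 0) :
    nome z = nome z₀ ∨ nome z = starRingEnd ℂ (nome z₀) := by
  obtain ⟨z₁, hnome, hre, him₁⟩ : ∃ z₁ : UpperHalfPlane, nome z₁ = nome z ∧ |z₁.re| ≤ 1 / 2 ∧
      z₁.im = z.im := by
    refine ⟨((-round z.re : ℤ) : ℝ) +ᵥ z, nome_int_vadd z _, ?_, UpperHalfPlane.vadd_im _ _⟩
    rw [UpperHalfPlane.vadd_re]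
    have := abs_sub_round z.re
    push_cast
    rwa [neg_add_eq_sub]
  have hE₁ : ModularForm.E hk z₁ = 0 := by
    rw [← eisensteinDisc_nome, hnome, eisensteinDisc_nome, hE]
  rw [← him₁] at hy
  rw [← hnome]
  by_cases hz : 1 ≤ Complex.normSq (z₁ : ℂ)
  · rcases huniq z₁ hre hz hy hE₁ with h | h
    · exact Or.inl (by rw [h])
    · exact Or.inr (by rw [h, nome_negConj])
  -- inside the unit disc, `-1 / z₁` would be a zero off the unit circle
  · exfalso
    push Not at hz
    have hns₁ : Complex.normSq (z₁ : ℂ) = z₁.re ^ 2 + z₁.im ^ 2 := by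
      rw [Complex.normSq_apply]
      change z₁.re * z₁.re + z₁.im * z₁.im = _
      ring
    have hpos : 0 < Complex.normSq (z₁ : ℂ) := Complex.normSq_pos.2 z₁.ne_zero
    set z₂ : UpperHalfPlane := ⟨(-(z₁ : ℂ))⁻¹, z₁.im_inv_neg_coe_pos⟩ with hz₂
    have hE₂ : ModularForm.E hk z₂ = 0 := by rw [hz₂, E_neg_inv, hE₁, mul_zero]
    have hre₂ : z₂.re = -z₁.re / Complex.normSq (z₁ : ℂ) := by
      change ((-(z₁ : ℂ))⁻¹).re = _
      rw [Complex.inv_re]; simp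
    have him₂ : z₂.im = z₁.im / Complex.normSq (z₁ : ℂ) := by
      change ((-(z₁ : ℂ))⁻¹).im = _
      rw [Complex.inv_im]; simp
    have hns₂ : Complex.normSq (z₂ : ℂ) = (Complex.normSq (z₁ : ℂ))⁻¹ := by
      change Complex.normSq ((-(z₁ : ℂ))⁻¹) = _
      rw [map_inv₀, Complex.normSq_neg]
    have hgt : 1 < Complex.normSq (z₂ : ℂ) := by
      rw [hns₂]; exact (one_lt_inv₀ hpos).2 hz
    have hone : z₂ = z₀ ∨ z₂ = negConj z₀ := by
      refine huniq z₂ ?_ hgt.le ?_ hE₂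
      · rw [hre₂, abs_div, abs_neg, abs_of_pos hpos, div_le_iff₀ hpos, ← abs_of_nonneg
          (by positivity : 0 ≤ 1 / 2 * Complex.normSq (z₁ : ℂ)), ← sq_le_sq]
        nlinarith
      · rw [him₂]
        refine hy.trans ?_
        rw [le_div_iff₀ hpos]
        nlinarith [z₁.im_pos]
    rcases hone with h | h
    · rw [h, hns] at hgt; exact lt_irrefl _ hgt
    · rw [h] at hgt
      have : Complex.normSq (negConj z₀ : ℂ) = 1 := by simpa [negConj] using hns
      rw [this] at hgt
      exact lt_irrefl _ hgt

/-- The zero on the arc is simple, because the Eisenstein series is expanding in the coordinate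
`w` of `arcBox`. -/
theorem deriv_eisensteinDisc_ne_zero {j : ℕ} (hk4 : (12 + 2 * j) % 4 = 0) (hk : 3 ≤ 12 + 2 * j)
    {z₀ : UpperHalfPlane} {a : ℝ} (ha : a ∈ Set.Icc (5 / 6 : ℝ) (7 / 6))
    (hz₀ : (z₀ : ℂ) = arcPoint (12 + 2 * j) a) : deriv (eisensteinDisc hk) (nome z₀) ≠ 0 := by
  intro hd
  set k := 12 + 2 * j with hkj
  set ψ : ℂ → ℂ := fun w => Complex.exp (2 * Real.pi * Complex.I * arcPoint k w) with hψ
  have hψa : ψ a = nome z₀ := by rw [nome, hz₀]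
  have hF : HasDerivAt (eisensteinDisc hk) 0 (ψ a) := by
    rw [hψa, ← hd]
    exact ((differentiableOn_eisensteinDisc hk).differentiableAt
      (Metric.isOpen_ball.mem_nhds (by simpa using norm_nome_lt_one z₀))).hasDerivAt
  have hψd := ((hasDerivAt_arcPoint k (a : ℂ)).const_mul (2 * Real.pi * Complex.I)).cexp
  have hcomp := hF.comp (a : ℂ) hψd
  rw [zero_mul] at hcomp
  have hsmall := (hasDerivAt_iff_isLittleO.1 hcomp).def (by norm_num : (0 : ℝ) < 0.1)
  obtain ⟨δ, hδ, hball⟩ := Metric.eventually_nhds_iff.1 hsmall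
  -- move from `a` in the imaginary direction, which stays in `arcBox`
  set t : ℝ := min (δ / 2) (1 / 4) with ht
  have ht0 : 0 < t := by positivity
  have ht1 : t < δ := (min_le_left _ _).trans_lt (by linarith)
  have ht2 : t ≤ 1 / 4 := min_le_right _ _
  set w : ℂ := (a : ℂ) + t * Complex.I with hw
  have hwa : ‖w - a‖ = t := by
    rw [hw, add_sub_cancel_left, norm_mul, Complex.norm_I, mul_one, Complex.norm_real,
      Real.norm_eq_abs, abs_of_pos ht0]
  have hwbox : w ∈ arcBox := by
    simp only [arcBox, Set.mem_ofPred_eq, hw, Complex.add_re, Complex.add_im, Complex.mul_re,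
      Complex.mul_im, Complex.ofReal_re, Complex.ofReal_im, Complex.I_re, Complex.I_im]
    refine ⟨by linarith [ha.1], by linarith [ha.2], by linarith, by linarith⟩
  have hval : ∀ w ∈ arcBox, eisensteinDisc hk (ψ w) = arcEisenstein k w := by
    intro w hw
    have := eisensteinDisc_nome hk ⟨arcPoint k w, arcPoint_im_pos (by omega) hw⟩
    rw [E_eq_arcEisenstein hk4 hk hw rfl] at this
    exact this
  have h1 := hball (y := w) (by rw [dist_eq_norm, hwa]; exact ht1)
  have hbox := ofReal_mem_arcBox ha
  simp only [Function.comp, smul_zero, sub_zero] at h1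
  have h2 := norm_arcEisenstein_sub_ge (j := j) hwbox hbox
  rw [← hkj, ← hval w hwbox, ← hval a hbox] at h2
  rw [hwa] at h1 h2
  have h3 := h2.trans h1
  linarith

theorem nome_ne_conj {z : UpperHalfPlane} (h0 : 0 < z.re) (h1 : z.re < 1 / 2) :
    nome z ≠ starRingEnd ℂ (nome z) := by
  intro h
  have him := Complex.conj_eq_iff_im.1 h.symm
  rw [nome, Complex.exp_im] at him
  have e : (2 * (Real.pi : ℂ) * Complex.I * (z : ℂ)).im = 2 * Real.pi * z.re := by
    simp [Complex.mul_im, Complex.mul_re]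
  rw [e] at him
  have hpi := Real.pi_pos
  have : 0 < Real.sin (2 * Real.pi * z.re) :=
    Real.sin_pos_of_pos_of_lt_pi (by positivity) (by nlinarith)
  exact (mul_pos (Real.exp_pos _) this).ne' him

theorem abs_re_le_and_one_le_normSq {z : UpperHalfPlane} (hz : z ∈ standardDomain) :
    |z.re| ≤ 1 / 2 ∧ 1 ≤ Complex.normSq (z : ℂ) := by
  rw [Complex.normSq_eq_norm_sq, one_le_sq_iff₀ (norm_nonneg _), abs_le]
  rcases hz with ⟨h1, h2, h3⟩ | ⟨h1, h2, h3⟩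
  · exact ⟨⟨by linarith, h3⟩, h1⟩
  · exact ⟨⟨by linarith, by linarith⟩, h1.le⟩

/-- Of the two zeros of maximal height, only `z₀` belongs to the half-open standard domain. -/
theorem isHighestZero_iff {k : ℕ} (hk : 3 ≤ k) {z₀ : UpperHalfPlane}
    (hE : ModularForm.E hk z₀ = 0) (hns : Complex.normSq (z₀ : ℂ) = 1)
    (h0 : 0 < z₀.re) (h1 : z₀.re < 1 / 2)
    (huniq : ∀ z : UpperHalfPlane, |z.re| ≤ 1 / 2 → 1 ≤ Complex.normSq (z : ℂ) → z₀.im ≤ z.im →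
        ModularForm.E hk z = 0 → z = z₀ ∨ z = negConj z₀) (z : UpperHalfPlane) :
    IsHighestZero hk z ↔ z = z₀ := by
  have hnorm : ‖(z₀ : ℂ)‖ = 1 := by
    rw [Complex.normSq_eq_norm_sq] at hns
    exact (pow_eq_one_iff_of_nonneg (norm_nonneg _) two_ne_zero).1 hns
  have hmem : z₀ ∈ standardDomain := Or.inl ⟨hnorm.ge, h0.le, h1.le⟩
  constructor
  · rintro ⟨hz, hzE, hmax⟩
    obtain ⟨h2, h3⟩ := abs_re_le_and_one_le_normSq hz
    rcases huniq z h2 h3 (hmax z₀ hmem hE) hzE with h | h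
    · exact h
    · exfalso
      have hre : z.re = -z₀.re := by rw [h, re_negConj]
      have hn : ‖(z : ℂ)‖ = 1 := by rw [h]; simpa [negConj] using hnorm
      rcases hz with ⟨-, h4, -⟩ | ⟨h4, -, -⟩
      · linarith
      · linarith
  · rintro rfl
    refine ⟨hmem, hE, fun w hw hwE => ?_⟩
    by_contra! hlt
    obtain ⟨h2, h3⟩ := abs_re_le_and_one_le_normSq hw
    rcases huniq w h2 h3 hlt.le hwE with h | h
    · rw [h] at hlt; exact lt_irrefl _ hlt
    · rw [h, im_negConj] at hlt; exact lt_irrefl _ hlt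

theorem theorem4 (k : ℕ) (hk : 12 ≤ k) (hk4 : k % 4 = 0) (hk3 : 3 ≤ k) :
    -- the highest zero `z_k` in the fundamental domain exists and is unique
    (∃! z : UpperHalfPlane, IsHighestZero hk3 z) ∧
    ∀ z : UpperHalfPlane, IsHighestZero hk3 z →
      -- the `q`-expansion of `1 / E_k` has radius of convergence `|q_{z_k}|` ...
      (FormalMultilinearSeries.ofScalars ℂ (reciprocalCoeff hk3)).radius =
          ENNReal.ofReal ‖nome z‖ ∧
      -- ... and represents `1 / E_k` inside its disc of convergence
      (∀ w : UpperHalfPlane, ‖nome w‖ < ‖nome z‖ →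
        ModularForm.E hk3 w ≠ 0 ∧
        HasSum (fun n : ℕ => reciprocalCoeff hk3 n * nome w ^ n) (1 / ModularForm.E hk3 w)) ∧
      -- the two denominators do not vanish
      seriesValue (ramanujanTheta (eisensteinQ hk3)) (nome z) ≠ 0 ∧
      seriesValue (ramanujanTheta (eisensteinQ hk3)) (starRingEnd ℂ (nome z)) ≠ 0 ∧
      Filter.Tendsto
        (fun n : ℕ =>
          reciprocalCoeff hk3 n * nome z ^ n
            + 1 / seriesValue (ramanujanTheta (eisensteinQ hk3)) (nome z)
            + 1 / seriesValue (ramanujanTheta (eisensteinQ hk3)) (starRingEnd ℂ (nome z))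
              * (nome z / starRingEnd ℂ (nome z)) ^ n)
        Filter.atTop (nhds 0) := by
  obtain ⟨j, rfl⟩ : ∃ j, k = 12 + 2 * j := ⟨(k - 12) / 2, by omega⟩
  have heven : Even (12 + 2 * j) := ⟨6 + j, by ring⟩
  obtain ⟨z₀, a, ha, hz₀a, hE₀, hns, h0, h1, him, huniq⟩ := exists_dominant_zero hk4 hk3
  have hiff := isHighestZero_iff hk3 hE₀ hns h0 h1 huniq
  refine ⟨⟨z₀, (hiff z₀).2 rfl, fun z hz => (hiff z).1 hz⟩, fun z hz => ?_⟩
  obtain rfl := (hiff z).1 hz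
  set F := eisensteinDisc hk3 with hF
  set q₀ := nome z with hq₀
  set q₁ := starRingEnd ℂ q₀ with hq₁
  have hlt : ‖q₀‖ < 1 := norm_nome_lt_one z
  have hmod : ‖q₁‖ = ‖q₀‖ := Complex.norm_conj _
  have hq₀0 : q₀ ≠ 0 := nome_ne_zero z
  have hFd := differentiableOn_eisensteinDisc hk3
  have hFs : ∀ q : ℂ, ‖q‖ < 1 → HasSum (fun n => (eisensteinQ hk3).coeff n * q ^ n) (F q) :=
    fun q hq => hasSum_eisensteinDisc hk3 hq
  have hz₀ : F q₀ = 0 := by rw [hF, eisensteinDisc_nome, hE₀]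
  have hz₁ : F q₁ = 0 := by rw [hF, hq₁, eisensteinDisc_conj hk3 heven hlt, ← hF, hz₀, map_zero]
  have hne : q₀ ≠ q₁ := nome_ne_conj h0 h1
  have hzeros : ∀ q, ‖q‖ ≤ ‖q₀‖ → F q = 0 → q = q₀ ∨ q = q₁ := by
    intro q hq hFq
    have hq0 : q ≠ 0 := by
      rintro rfl
      rw [hF, eisensteinDisc_zero hk3 heven] at hFq
      exact one_ne_zero hFq
    obtain ⟨w, rfl⟩ := exists_nome_eq hq0 (hq.trans_lt hlt)
    rw [hF, eisensteinDisc_nome] at hFq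
    exact nome_eq_of_zero hk3 hns him huniq (norm_nome_le_iff.1 hq) hFq
  have hzeros' : ∀ q, ‖q‖ < ‖q₀‖ → F q ≠ 0 := by
    intro q hq h
    rcases hzeros q hq.le h with rfl | rfl
    · exact lt_irrefl _ hq
    · exact hq.ne hmod
  have hd₀ : deriv F q₀ ≠ 0 := deriv_eisensteinDisc_ne_zero hk4 hk3 ha hz₀a
  have hΘ₀ := seriesValue_ramanujanTheta hFs hlt
  have hΘ₁ := seriesValue_ramanujanTheta hFs (hmod.trans_lt hlt)
  have hΘ₀ne : seriesValue (ramanujanTheta (eisensteinQ hk3)) q₀ ≠ 0 := by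
    rw [hΘ₀]; exact mul_ne_zero hq₀0 hd₀
  have hΘ₁ne : seriesValue (ramanujanTheta (eisensteinQ hk3)) q₁ ≠ 0 := by
    rw [hq₁, seriesValue_theta_conj hk3 heven]
    exact (map_ne_zero _).2 hΘ₀ne
  have hd₁ : deriv F q₁ ≠ 0 := fun h => hΘ₁ne (by rw [hΘ₁, h, mul_zero])
  refine ⟨reciprocal_radius hFd hFs hq₀0 hlt hz₀ hzeros', fun w hw => ?_, hΘ₀ne, hΘ₁ne, ?_⟩
  · have hFw := hzeros' _ hw
    rw [hF, eisensteinDisc_nome] at hFw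
    refine ⟨hFw, ?_⟩
    have := reciprocal_hasSum (norm_pos_iff.2 hq₀0) (hFd.mono (Metric.ball_subset_ball hlt.le))
      (fun q hq => hFs q (hq.trans hlt)) hzeros' hw
    rw [eisensteinDisc_nome] at this
    simpa [reciprocalCoeff] using this
  · rw [hΘ₀, hΘ₁]
    exact reciprocal_coeff_tendsto hFd hFs hq₀0 hlt hmod hne hz₀ hz₁ hzeros hd₀ hd₁
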